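/- **Setting.** Let $(X_i)_{i\ge 0}$ be real random variables on a probability space, let $W_0=0$, $W_{n+1}=\max(W_n+X_n,0)$ for $n\ge0$, and for $t\in[0,1]$ put $$x^n(t)=\frac1n\sum_{i=0}^{\lfloor nt\rfloor-1}X_i,\qquad \bar w^n(t)=\frac1{n^2}\sum_{i=1}^{\lfloor nt\rfloor}W_i+\frac1{n^2}(nt-\lfloor nt\rfloor)W_{\lfloor nt\rfloor+1}.$$ $C[0,1]$ carries the supremum norm; $D[0,1]$ is the space of real càdlàg functions on $[0,1]$ with the Skorohod $J_1$ metric $d(\phi,\psi)=\inf_\lambda\max(\|\phi\circ\lambda-\psi\|,\|\lambda-e\|)$, the infimum being over the increasing homeomorphisms $\lambda$ of $[0,1]$, with $e$ the identity; $L[0,1]\subset D[0,1]$ is the set of functions of finite variation. To $\gamma\in L[0,1]$ belongs the signed measure $m$ on $[0,1]$ with $m([0,t])=\gamma(t)$ (so $m$ has the atom $\gamma(0)$ at $0$). Let $\dot\gamma^{(a)}$ be the density of its absolutely continuous part with respect to Lebesgue measure, and let $\gamma^{\uparrow}(1),\gamma^{\downarrow}(1)\ge0$ be the total masses of the positive and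 negative parts of its singular part. LDPs are with a speed $a_n\to\infty$ (for instance $a_n=n$). A rate function is a lower semicontinuous function with values in $[0,\infty]$; it is good if its sublevel sets $\{\cdot\le c\}$, $c<\infty$, are compact. For $J:D[0,1]\to[0,\infty]$ and $\phi\in C[0,1]$ let $$\mathcal C J(\phi)=\inf\Big\{J(\gamma):\gamma\in D[0,1],\ \int_0^t\sup_{s\le r}(\gamma(r)-\gamma(s))\,dr=\phi(t)\ \text{ for all } t\in[0,1]\Big\}.$$ For $I:\mathbb R\to[0,\infty]$ and $\theta^\downarrow,\theta^\uparrow\in[0,\infty]$ let (with $\infty\cdot0=0$) $$M_{I,\theta}(\gamma)=\int_0^1I(\dot\gamma^{(a)}(s))\,ds+\theta^\downarrow\gamma^\downarrow(1)+\theta^\uparrow\gamma^\uparrow(1)\ \text{ if }\gamma\in L[0,1],\qquad M_{I,\theta}(\gamma)=\infty\ \text{ otherwise.}$$ Say that $\phi\in C[0,1]$ has velocity $\dot\phi\in L[0,1]$ if $\phi(0)=0$ and $\dot\phi$ is a non-negative element of $L[0,1]$ that is the right derivative of $\phi$ at every $t\in[0,1)$ and the left derivative of $\phi$ at $t=1$.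 Put then $$K_{I,\theta}(\dot\phi)=\int_0^1\Big(I(\ddot\phi^{(a)}(s))1_{\{\dot\phi(s)>0\}}+\inf_{y\le0}I(y)\,1_{\{\dot\phi(s)=0\}}\Big)ds+\theta^\downarrow\dot\phi^\downarrow(1)+\theta^\uparrow\dot\phi^\uparrow(1).$$ **Theorem.** Assume that $\{x^n\}$ satisfies the LDP in $D[0,1]$ with good rate function $I_X$, and put $I_{\overline W}=\mathcal C I_X$. (i) $\{\bar w^n\}$ satisfies the LDP in $C[0,1]$, at the same speed, with rate function $I_{\overline W}$, which is good. If $I_X=\infty$ outside $L[0,1]$, then the infimum that defines $I_{\overline W}$ may be restricted to $\gamma\in L[0,1]$. (ii) Suppose that $I_X=M_{I,\theta}$ for some $I:\mathbb R\to[0,\infty]$ and $\theta^\downarrow,\theta^\uparrow\in[0,\infty]$. If $I_{\overline W}(\phi)<\infty$, then $\phi$ is differentiable at every point of $[0,1]$ (one-sidedly at the end points) and has velocity $\dot\phi\in L[0,1]$. For every $\phi$ that has velocity $\dot\phi\in L[0,1]$, $I_{\overline W}(\phi)=K_{I,\theta}(\dot\phi)$. (iii) The formula also holds for functionals of this form irrespective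 of any LDP: for all $I:\mathbb R\to[0,\infty]$ and $\theta^\downarrow,\theta^\uparrow\in[0,\infty]$, if $\mathcal C M_{I,\theta}(\phi)<\infty$ then $\phi$ has a velocity $\dot\phi\in L[0,1]$ with $\dot\phi(0)=0$; and $\mathcal C M_{I,\theta}(\phi)=K_{I,\theta}(\dot\phi)$ for every $\phi$ that has velocity $\dot\phi\in L[0,1]$ with $\dot\phi(0)=0$. -/

import Mathlib

open MeasureTheory Filter Topology Set
open scoped ENNReal NNReal unitInterval

noncomputable section

namespace ReflectedWalk

/-! ### Large deviation principles -/

/-- A good rate function: lower semicontinuous with compact sublevel sets. -/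
structure IsGoodRateFunction {E : Type*} [TopologicalSpace E] (J : E → ℝ≥0∞) : Prop where
  lowerSemicontinuous : LowerSemicontinuous J
  isCompact_sublevel : ∀ c : ℝ≥0, IsCompact {x | J x ≤ (c : ℝ≥0∞)}

/-- The large deviation principle, with speed `a n` and rate function `J`, for the random elements
`Y n` of the topological space `E`, defined on the probability space `(Ω, P)`. -/
structure SatisfiesLDP {Ω E : Type*} [MeasurableSpace Ω] [TopologicalSpace E] (P : Measure Ω)
    (Y : ℕ → Ω → E) (a : ℕ → ℝ) (J : E → ℝ≥0∞) : Prop where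
  lowerSemicontinuous : LowerSemicontinuous J
  upper : ∀ F : Set E, IsClosed F →
    limsup (fun n => ENNReal.log (P (Y n ⁻¹' F)) / (a n : EReal)) atTop
      ≤ -((⨅ x ∈ F, J x : ℝ≥0∞) : EReal)
  lower : ∀ G : Set E, IsOpen G →
    -((⨅ x ∈ G, J x : ℝ≥0∞) : EReal)
      ≤ liminf (fun n => ENNReal.log (P (Y n ⁻¹' G)) / (a n : EReal)) atTop

/-! ### The Skorohod space `D[0,1]` -/

/-- Real-valued càdlàg functions on `[0,1]`. -/
structure SkorohodSpace where
  /-- The underlying function. -/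
  toFun : I → ℝ
  right_continuous : ∀ t, ContinuousWithinAt toFun (Ici t) t
  left_limit : ∀ t, ∃ l, Tendsto toFun (𝓝[<] t) (𝓝 l)

namespace SkorohodSpace

instance : CoeFun SkorohodSpace (fun _ => I → ℝ) := ⟨toFun⟩

/-- The cost `max (‖φ ∘ lam - ψ‖, ‖lam - e‖)` of the time change `lam`. Strictly increasing maps
of `[0,1]` that are continuous with a continuous inverse are the order isomorphisms of `[0,1]`. -/
def cost (φ ψ : SkorohodSpace) (lam : I ≃o I) : ℝ≥0∞ :=
  max (⨆ t, edist (φ (lam t)) (ψ t)) (⨆ t, edist (lam t) t)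

lemma cost_symm (φ ψ : SkorohodSpace) (lam : I ≃o I) :
    cost ψ φ lam.symm = cost φ ψ lam := by
  unfold cost
  congr 1
  · rw [← lam.toEquiv.iSup_comp]
    simp [edist_comm]
  · rw [← lam.toEquiv.iSup_comp]
    simp [edist_comm]

lemma cost_trans (φ ψ χ : SkorohodSpace) (lam mu : I ≃o I) :
    cost φ χ (mu.trans lam) ≤ cost φ ψ lam + cost ψ χ mu := by
  unfold cost
  refine max_le (iSup_le fun t => ?_) (iSup_le fun t => ?_)
  · refine (edist_triangle _ (ψ (mu t)) _).trans (add_le_add ?_ ?_)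
    · exact (le_iSup (fun t => edist (φ (lam t)) (ψ t)) (mu t)).trans (le_max_left _ _)
    · exact (le_iSup (fun t => edist (ψ (mu t)) (χ t)) t).trans (le_max_left _ _)
  · refine (edist_triangle _ (mu t) _).trans (add_le_add ?_ ?_)
    · exact (le_iSup (fun t => edist (lam t) t) (mu t)).trans (le_max_right _ _)
    · exact (le_iSup (fun t => edist (mu t) t) t).trans (le_max_right _ _)

/-- Skorohod's `J₁` metric `d(φ, ψ) = inf_lam max (‖φ ∘ lam - ψ‖, ‖lam - e‖)`, and the topology
that it induces. -/
instance : PseudoEMetricSpace SkorohodSpace where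
  edist φ ψ := ⨅ lam : I ≃o I, cost φ ψ lam
  edist_self φ := by
    refine le_antisymm ((iInf_le _ (OrderIso.refl I)).trans ?_) zero_le
    simp [cost]
  edist_comm φ ψ := by
    refine le_antisymm ?_ ?_
    · exact le_iInf fun lam => (iInf_le _ lam.symm).trans (cost_symm ψ φ lam).le
    · exact le_iInf fun lam => (iInf_le _ lam.symm).trans (cost_symm φ ψ lam).le
  edist_triangle φ ψ χ := by
    refine ENNReal.le_iInf_add_iInf fun lam mu => ?_
    exact (iInf_le _ (mu.trans lam)).trans (cost_trans φ ψ χ lam mu)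

end SkorohodSpace

/-- Membership of `γ ∈ D[0,1]` in `L[0,1]`, the set of functions of finite variation. -/
def HasFiniteVariation (γ : SkorohodSpace) : Prop := BoundedVariationOn γ.toFun univ

/-- The extension of `γ` to `ℝ` by `0` to the left of `0` and by `γ 1` to the right of `1`. -/
def extend (γ : SkorohodSpace) (t : ℝ) : ℝ := if t < 0 then 0 else γ (projIcc 0 1 zero_le_one t)

lemma HasFiniteVariation.extend {γ : SkorohodSpace} (h : HasFiniteVariation γ) :
    BoundedVariationOn (extend γ) univ := by
  have hu : (univ : Set ℝ) = Iic 0 ∪ Ici 0 := Iic_union_Ici.symm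
  have h1 : eVariationOn (ReflectedWalk.extend γ) (Iic 0) ≠ ⊤ := by
    have e : EqOn (ReflectedWalk.extend γ)
        ((fun b : Bool => if b then γ 0 else 0) ∘ fun t : ℝ => decide (0 ≤ t)) (Iic 0) := by
      intro t ht
      rcases eq_or_lt_of_le (show t ≤ 0 from ht) with rfl | ht'
      · simp [ReflectedWalk.extend]
      · simp [ReflectedWalk.extend, ht', not_le.2 ht']
    have hm : Monotone fun t : ℝ => decide (0 ≤ t) := by
      intro x y hxy
      simp only [Bool.le_iff_imp, decide_eq_true_eq]
      exact fun hx => hx.trans hxy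
    rw [eVariationOn.congr e]
    refine ne_top_of_le_ne_top ?_
      (eVariationOn.comp_le_of_monotoneOn (s := univ) _ _ (hm.monotoneOn _) (mapsTo_univ _ _))
    exact BoundedVariationOn.of_finite _ _
  have h2 : eVariationOn (ReflectedWalk.extend γ) (Ici 0) ≠ ⊤ := by
    have e : EqOn (ReflectedWalk.extend γ) (γ.toFun ∘ projIcc (0 : ℝ) 1 zero_le_one) (Ici 0) := by
      intro t ht
      simp [ReflectedWalk.extend, not_lt.2 (show 0 ≤ t from ht)]
    rw [eVariationOn.congr e]
    exact ne_top_of_le_ne_top h (eVariationOn.comp_le_of_monotoneOn _ _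
      (Monotone.monotoneOn (monotone_projIcc zero_le_one) _) (mapsTo_univ _ _))
  unfold BoundedVariationOn
  rw [hu, eVariationOn.union _ isGreatest_Iic isLeast_Ici]
  exact ENNReal.add_ne_top.2 ⟨h1, h2⟩

open scoped Classical in
/-- For `γ ∈ L[0,1]`, the signed measure `m` on `ℝ`, carried by `[0,1]`, with `m [0,t] = γ t` for
`t ∈ [0,1]`; it has the atom `γ 0` at the point `0`. (Junk value `0` if `γ ∉ L[0,1]`.) -/
def stieltjes (γ : SkorohodSpace) : SignedMeasure ℝ :=
  if h : HasFiniteVariation γ then h.extend.vectorMeasure else 0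

/-- The density of the absolutely continuous part of `γ ∈ L[0,1]`. -/
def acDeriv (γ : SkorohodSpace) : ℝ → ℝ := (stieltjes γ).rnDeriv volume

/-- The total mass of the positive part of the singular part of `γ ∈ L[0,1]`. -/
def singularUp (γ : SkorohodSpace) : ℝ≥0∞ :=
  ((stieltjes γ).singularPart volume).toJordanDecomposition.posPart univ

/-- The total mass of the negative part of the singular part of `γ ∈ L[0,1]`. -/
def singularDown (γ : SkorohodSpace) : ℝ≥0∞ :=
  ((stieltjes γ).singularPart volume).toJordanDecomposition.negPart univ

/-! ### The scaled paths -/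

/-- Lindley's recursion `W 0 = 0`, `W (n + 1) = [W n + X n]⁺`. -/
def lindley (X : ℕ → ℝ) : ℕ → ℝ
  | 0 => 0
  | n + 1 => max (lindley X n + X n) 0

lemma floor_path_right (n : ℕ) (t : I) :
    ∀ᶠ s : I in 𝓝[≥] t, ⌊(n : ℝ) * s⌋₊ = ⌊(n : ℝ) * t⌋₊ := by
  have h : Tendsto (fun s : I => (n : ℝ) * s) (𝓝[≥] t) (𝓝[≥] ((n : ℝ) * t)) := by
    refine tendsto_nhdsWithin_iff.2 ⟨?_, ?_⟩
    · exact (Continuous.tendsto (by fun_prop) t).mono_left nhdsWithin_le_nhds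
    · filter_upwards [self_mem_nhdsWithin] with s hs
      have hs' : (t : ℝ) ≤ s := hs
      exact mul_le_mul_of_nonneg_left hs' (Nat.cast_nonneg n)
  have h2 := tendsto_pure.1 ((tendsto_floor_right_pure_floor ((n : ℝ) * t)).comp h)
  filter_upwards [h2] with s hs
  have : ⌊(n : ℝ) * s⌋ = ⌊(n : ℝ) * t⌋ := hs
  rw [← Int.floor_toNat, ← Int.floor_toNat, this]

lemma floor_path_left (n : ℕ) (t : I) :
    ∃ k : ℕ, ∀ᶠ s : I in 𝓝[<] t, ⌊(n : ℝ) * s⌋₊ = k := by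
  rcases Nat.eq_zero_or_pos n with rfl | hn
  · exact ⟨0, by simp⟩
  have h : Tendsto (fun s : I => (n : ℝ) * s) (𝓝[<] t) (𝓝[<] ((n : ℝ) * t)) := by
    refine tendsto_nhdsWithin_iff.2 ⟨?_, ?_⟩
    · exact (Continuous.tendsto (by fun_prop) t).mono_left nhdsWithin_le_nhds
    · filter_upwards [self_mem_nhdsWithin] with s hs
      have hs' : (s : ℝ) < t := hs
      exact mul_lt_mul_of_pos_left hs' (Nat.cast_pos.2 hn)
  have h2 := tendsto_pure.1 ((tendsto_floor_left_pure_ceil_sub_one ((n : ℝ) * t)).comp h)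
  refine ⟨(⌈(n : ℝ) * t⌉ - 1).toNat, ?_⟩
  filter_upwards [h2] with s hs
  have : ⌊(n : ℝ) * s⌋ = ⌈(n : ℝ) * t⌉ - 1 := hs
  rw [← Int.floor_toNat, this]

/-- The scaled path `xⁿ(t) = n⁻¹ ∑_{i=0}^{⌊nt⌋-1} X i` of the unconstrained walk. -/
def walkPath (X : ℕ → ℝ) (n : ℕ) : SkorohodSpace where
  toFun t := (1 / (n : ℝ)) * ∑ i ∈ Finset.range ⌊(n : ℝ) * t⌋₊, X i
  right_continuous t := by
    refine ContinuousWithinAt.congr_of_eventuallyEq continuousWithinAt_const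
      (f := fun _ => (1 / (n : ℝ)) * ∑ i ∈ Finset.range ⌊(n : ℝ) * t⌋₊, X i) ?_ rfl
    filter_upwards [floor_path_right n t] with s hs
    rw [hs]
  left_limit t := by
    obtain ⟨k, hk⟩ := floor_path_left n t
    refine ⟨(1 / (n : ℝ)) * ∑ i ∈ Finset.range k, X i, tendsto_const_nhds.congr' ?_⟩
    filter_upwards [hk] with s hs
    rw [hs]

lemma polygon_eq (w : ℕ → ℝ) (n : ℕ) (t : I) :
    ∑ i ∈ Finset.Icc 1 ⌊(n : ℝ) * t⌋₊, w i
      + ((n : ℝ) * t - ⌊(n : ℝ) * t⌋₊) * w (⌊(n : ℝ) * t⌋₊ + 1)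
    = ∑ i ∈ Finset.range (n + 1), max 0 (min 1 ((n : ℝ) * t - i)) * w (i + 1) := by
  have h0 : (0 : ℝ) ≤ (n : ℝ) * t := mul_nonneg (Nat.cast_nonneg n) t.2.1
  have h1 : (n : ℝ) * t ≤ n := mul_le_of_le_one_right (Nat.cast_nonneg n) t.2.2
  generalize (n : ℝ) * t = u at *
  have hk : ⌊u⌋₊ ≤ n := Nat.floor_le_of_le h1
  have hl := Nat.floor_le h0
  have hr := Nat.lt_floor_add_one u
  generalize ⌊u⌋₊ = k at *
  have hI : ∑ i ∈ Finset.Icc 1 k, w i = ∑ i ∈ Finset.range k, w (i + 1) := by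
    rw [Finset.range_eq_Ico, Finset.sum_Ico_add' w 0 k 1]
    rfl
  rw [hI, show n + 1 = (k + 1) + (n - k) by omega, Finset.sum_range_add, Finset.sum_range_succ]
  have e1 : ∑ i ∈ Finset.range k, max 0 (min 1 (u - (i : ℝ))) * w (i + 1)
      = ∑ i ∈ Finset.range k, w (i + 1) := by
    refine Finset.sum_congr rfl fun i hi => ?_
    have : (i : ℝ) + 1 ≤ k := by exact_mod_cast Finset.mem_range.1 hi
    rw [min_eq_left (by linarith), max_eq_right zero_le_one, one_mul]
  have e2 : ∑ i ∈ Finset.range (n - k),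
      max 0 (min 1 (u - ((k + 1 + i : ℕ) : ℝ))) * w (k + 1 + i + 1) = 0 := by
    refine Finset.sum_eq_zero fun i _ => ?_
    have : (0 : ℝ) ≤ i := Nat.cast_nonneg i
    push_cast
    rw [max_eq_left ((min_le_right _ _).trans (by linarith)), zero_mul]
  rw [e1, e2, min_eq_right (by linarith), max_eq_right (by linarith), add_zero]

/-- The polygonal path of the rescaled simulated mean,
`w̄ⁿ(t) = n⁻² ∑_{i=1}^{⌊nt⌋} W i + n⁻² (nt - ⌊nt⌋) W (⌊nt⌋ + 1)`, as an element of `C[0,1]`. -/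
def meanPath (X : ℕ → ℝ) (n : ℕ) : C(I, ℝ) where
  toFun t := (1 / (n : ℝ) ^ 2) * ∑ i ∈ Finset.Icc 1 ⌊(n : ℝ) * t⌋₊, lindley X i
    + (1 / (n : ℝ) ^ 2) * ((n : ℝ) * t - ⌊(n : ℝ) * t⌋₊) * lindley X (⌊(n : ℝ) * t⌋₊ + 1)
  continuous_toFun := by
    have h : ∀ t : I, (1 / (n : ℝ) ^ 2) * ∑ i ∈ Finset.Icc 1 ⌊(n : ℝ) * t⌋₊, lindley X i
        + (1 / (n : ℝ) ^ 2) * ((n : ℝ) * t - ⌊(n : ℝ) * t⌋₊) * lindley X (⌊(n : ℝ) * t⌋₊ + 1)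
        = (1 / (n : ℝ) ^ 2) * ∑ i ∈ Finset.range (n + 1),
          max 0 (min 1 ((n : ℝ) * t - i)) * lindley X (i + 1) := by
      intro t
      rw [← polygon_eq]
      ring
    simp_rw [h]
    fun_prop

/-! ### The rate functions -/

/-- The Skorohod reflection map `f(γ)(t) = sup_{s ≤ t} (γ t - γ s)`. (Càdlàg functions on `[0,1]`
are bounded, so the supremum is finite.) -/
def reflect (γ : SkorohodSpace) (t : I) : ℝ := ⨆ s : Iic t, (γ t - γ s)

/-- `∫_0^t sup_{s ≤ r} (γ r - γ s) dr = φ t` for all `t ∈ [0,1]`. -/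
def ReflectsTo (γ : SkorohodSpace) (φ : C(I, ℝ)) : Prop :=
  ∀ t : I, ∫ r in (0 : ℝ)..t, reflect γ (projIcc 0 1 zero_le_one r) = φ t

/-- The contraction of `J` through the reflection map followed by integration. -/
def contractedRate (J : SkorohodSpace → ℝ≥0∞) (φ : C(I, ℝ)) : ℝ≥0∞ :=
  ⨅ (γ : SkorohodSpace) (_ : ReflectsTo γ φ), J γ

open scoped Classical in
/-- The integral form `∫_0^1 R(γ̇⁽ᵃ⁾(s)) ds + θ↓ γ↓(1) + θ↑ γ↑(1)` for `γ ∈ L[0,1]` and `+∞`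
otherwise, where `R` is the local rate function; here `∞ * 0 = 0`. -/
def integralRate (R : ℝ → ℝ≥0∞) (θdown θup : ℝ≥0∞) (γ : SkorohodSpace) : ℝ≥0∞ :=
  if HasFiniteVariation γ then
    (∫⁻ s in Icc (0 : ℝ) 1, R (acDeriv γ s)) + θdown * singularDown γ + θup * singularUp γ
  else ⊤

/-- The functional
`∫_0^1 (R(ψ̇⁽ᵃ⁾(s)) 1_{ψ(s) > 0} + inf_{y ≤ 0} R(y) 1_{ψ(s) = 0}) ds + θ↓ ψ↓(1) + θ↑ ψ↑(1)`. -/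
def explicitRate (R : ℝ → ℝ≥0∞) (θdown θup : ℝ≥0∞) (ψ : SkorohodSpace) : ℝ≥0∞ :=
  (∫⁻ s in Icc (0 : ℝ) 1,
      (indicator {s | 0 < extend ψ s} (fun s => R (acDeriv ψ s)) s
        + indicator {s | extend ψ s = 0} (fun _ => ⨅ y ≤ (0 : ℝ), R y) s))
    + θdown * singularDown ψ + θup * singularUp ψ

/-- `φ 0 = 0`, and the derivative `φ̇` exists (from the right at every `t < 1`, from the left at
`t = 1`), equals `ψ`, is non-negative and is an element of `L[0,1]`. -/
structure HasVelocity (φ : C(I, ℝ)) (ψ : SkorohodSpace) : Prop where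
  map_zero : φ 0 = 0
  hasDeriv_right : ∀ t : I, t < 1 →
    HasDerivWithinAt (IccExtend zero_le_one φ) (ψ t) (Ici (t : ℝ)) t
  hasDeriv_left : HasDerivWithinAt (IccExtend zero_le_one φ) (ψ 1) (Iic (1 : ℝ)) 1
  nonneg : ∀ t, 0 ≤ ψ t
  hasFiniteVariation : HasFiniteVariation ψ

end ReflectedWalk

end

open ReflectedWalk

open ReflectedWalk

namespace ReflectedWalk

/-! ### Càdlàg paths: boundedness, measurability, discontinuities -/

namespace SkorohodSpace

/-! Part (i) is a contraction principle with a small error. Put `F γ = γ.reflectPath.primitive`. If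
a time change brings two paths within `ε`, the same time change brings their reflections within `2
ε`. So `J₁` convergence gives convergence of the reflections at every continuity point of the limit,
and dominated convergence makes `F` continuous into `C[0,1]` (`continuous_primitive_reflectPath`).
The reflected scaled walk is Lindley's recursion divided by `n`, so `meanPath X n` and `F (walkPath
X n)` differ by at most `2 ‖xⁿ‖ / n`. Goodness of the rate function makes large norms
super-exponentially unlikely, and this error is therefore invisible to the LDP.

Part (iii) compares two signed measures. If `γ` reflects to a `φ` with velocity `ψ`, then `γ - ψ` is
on `[0,1)` the running infimum of `γ`. It decreases, and it is locally constant to the right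
wherever `ψ > 0`. Hence on `(0,1)` the measure of `γ` is at most that of `ψ`, with equality on
subsets of `{ψ > 0}`. On `{ψ = 0}` the density of `ψ` vanishes almost everywhere and its measure is
non-positive. So `γ` costs at least `explicitRate` (`explicitRate_le_integralRate`). Conversely `ψ +
y · (time spent at zero)` with `y ≤ 0` reflects to `ψ`, has density `y` almost everywhere on `{ψ =
0}`, and keeps the singular part of `ψ`; letting `R y` approach its infimum gives equality. These
set-wise statements rest on `signedMeasure_nonpos_of_Icc`, which tests a signed measure on `B` only
by intervals with end points in `B`.

Part (ii) reduces to (iii). An LDP forces some path to have finite rate. A finite price for a jump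
would then put paths with a fixed extra jump at times decreasing to `0` into one sublevel set,
although they have no `J₁` limit point. So goodness makes both jump prices infinite. Paths of finite
rate have no singular part, their reflections are continuous, and `φ` is differentiable everywhere.
A velocity with `ψ 0 > 0` has an atom at `0`, and both sides of the formula are then infinite. -/

lemma exists_bound (γ : SkorohodSpace) : ∃ C : ℝ, ∀ t, |γ t| ≤ C := by
  have key : ∃ C : ℝ, ∀ t ∈ (univ : Set I), |γ t| ≤ C := by
    refine isCompact_univ.induction_on (p := fun s => ∃ C : ℝ, ∀ t ∈ s, |γ t| ≤ C)
      ⟨0, by simp⟩ (fun s t hst ⟨C, hC⟩ => ⟨C, fun x hx => hC x (hst hx)⟩) ?_ ?_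
    · rintro s t ⟨C, hC⟩ ⟨D, hD⟩
      refine ⟨max C D, fun x hx => ?_⟩
      rcases hx with hx | hx
      · exact (hC x hx).trans (le_max_left _ _)
      · exact (hD x hx).trans (le_max_right _ _)
    · intro t _
      obtain ⟨l, hl⟩ := γ.left_limit t
      have h1 : ∀ᶠ s in 𝓝[<] t, |γ s| ≤ |l| + 1 :=
        (hl.abs.eventually_lt_const (lt_add_one _)).mono fun _ h => h.le
      have h2 : ∀ᶠ s in 𝓝[≥] t, |γ s| ≤ |γ t| + 1 :=
        ((γ.right_continuous t).abs.eventually_lt_const (lt_add_one _)).mono fun _ h => h.le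
      refine ⟨{s | |γ s| ≤ max (|l| + 1) (|γ t| + 1)}, mem_nhdsWithin_of_mem_nhds ?_, _,
        fun s hs => hs⟩
      rw [← nhdsLT_sup_nhdsGE]
      exact ⟨h1.mono fun s hs => hs.trans (le_max_left _ _),
        h2.mono fun s hs => hs.trans (le_max_right _ _)⟩
  obtain ⟨C, hC⟩ := key
  exact ⟨C, fun t => hC t (mem_univ t)⟩

/-- By right continuity the path is the pointwise limit of step functions that sample it at grid
points to the right of `t`. -/
lemma measurable (γ : SkorohodSpace) : Measurable γ.toFun := by
  let u : ℕ → I → I := fun n t =>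
    projIcc 0 1 zero_le_one (((⌊((n : ℝ) + 1) * t⌋₊ : ℝ) + 1) / ((n : ℝ) + 1))
  refine measurable_of_tendsto_metrizable (f := fun n t => γ (u n t)) (fun n => ?_) ?_
  · have h : Measurable fun k : ℕ =>
        γ (projIcc 0 1 zero_le_one (((k : ℝ) + 1) / ((n : ℝ) + 1))) := measurable_from_top
    exact h.comp (Nat.measurable_floor.comp (by fun_prop))
  · rw [tendsto_pi_nhds]
    intro t
    refine (γ.right_continuous t).tendsto.comp (tendsto_nhdsWithin_iff.2 ⟨?_, ?_⟩)
    · have h : Tendsto (fun n : ℕ => ((⌊((n : ℝ) + 1) * t⌋₊ : ℝ) + 1) / ((n : ℝ) + 1)) atTop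
          (𝓝 (t : ℝ)) := by
        have h0 : Tendsto (fun n : ℕ => (t : ℝ) + 1 / ((n : ℝ) + 1)) atTop (𝓝 (t + 0)) :=
          tendsto_const_nhds.add tendsto_one_div_add_atTop_nhds_zero_nat
        rw [add_zero] at h0
        refine tendsto_of_tendsto_of_tendsto_of_le_of_le tendsto_const_nhds h0 ?_ ?_
        · intro n
          have hp : (0 : ℝ) < (n : ℝ) + 1 := by positivity
          have := Nat.lt_floor_add_one (((n : ℝ) + 1) * t)
          rw [le_div_iff₀ hp]
          linarith
        · intro n
          have hp : (0 : ℝ) < (n : ℝ) + 1 := by positivity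
          have := Nat.floor_le (a := ((n : ℝ) + 1) * t) (mul_nonneg hp.le t.2.1)
          simp only
          rw [div_le_iff₀ hp, add_mul (t : ℝ), one_div_mul_cancel hp.ne']
          linarith
      have := (continuous_projIcc (h := zero_le_one' ℝ)).continuousAt (x := (t : ℝ))
        |>.tendsto.comp h
      rwa [projIcc_val] at this
    · refine Eventually.of_forall fun n => ?_
      have hp : (0 : ℝ) < (n : ℝ) + 1 := by positivity
      have h1 : (t : ℝ) ≤ ((⌊((n : ℝ) + 1) * t⌋₊ : ℝ) + 1) / ((n : ℝ) + 1) := by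
        have := Nat.lt_floor_add_one (((n : ℝ) + 1) * t)
        rw [le_div_iff₀ hp]
        linarith
      have h2 := monotone_projIcc (zero_le_one' ℝ) h1
      rwa [projIcc_val] at h2

end SkorohodSpace

/-- An upward jump at `t` is labelled by rationals `r < t` and `p` with `f < p` on `(r, t)` and `p ≤
f t`. Two times `t₁ < t₂` cannot share a label, since `f t₁` would be both at least `p` and below
`p`. -/
lemma countable_lt_of_tendsto_left (f : I → ℝ) :
    {t : I | 0 < t ∧ ∃ l, Tendsto f (𝓝[<] t) (𝓝 l) ∧ l < f t}.Countable := by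
  have hsub : {t : I | 0 < t ∧ ∃ l, Tendsto f (𝓝[<] t) (𝓝 l) ∧ l < f t} ⊆
      ⋃ p : ℚ × ℚ, {t : I | (p.1 : ℝ) < t ∧ (∀ u : I, (p.1 : ℝ) < u → u < t → f u < p.2) ∧
        p.2 ≤ f t} := by
    rintro t ⟨h0, l, hl, hlt⟩
    obtain ⟨p, hp1, hp2⟩ := exists_rat_btwn hlt
    obtain ⟨a, ha, hsub⟩ := (mem_nhdsLT_iff_exists_Ioo_subset' h0).1 (hl.eventually_lt_const hp1)
    obtain ⟨r, hr1, hr2⟩ := exists_rat_btwn (show (a : ℝ) < t from ha)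
    refine mem_iUnion.2 ⟨(r, p), hr2, fun u hu hut => hsub ⟨?_, hut⟩, hp2.le⟩
    exact Subtype.coe_lt_coe.1 (hr1.trans hu)
  refine Countable.mono hsub (countable_iUnion fun p => Set.Subsingleton.countable ?_)
  have aux : ∀ t₁ ∈ {t : I | (p.1 : ℝ) < t ∧ (∀ u : I, (p.1 : ℝ) < u → u < t → f u < p.2) ∧
        p.2 ≤ f t}, ∀ t₂ ∈ {t : I | (p.1 : ℝ) < t ∧
        (∀ u : I, (p.1 : ℝ) < u → u < t → f u < p.2) ∧ p.2 ≤ f t}, ¬ t₁ < t₂ :=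
    fun t₁ h₁ t₂ h₂ h => absurd (h₂.2.1 t₁ h₁.1 h) (not_lt.2 h₁.2.2)
  intro t₁ h₁ t₂ h₂
  exact le_antisymm (not_lt.1 (aux t₂ h₂ t₁ h₁)) (not_lt.1 (aux t₁ h₁ t₂ h₂))

namespace SkorohodSpace

lemma countable_not_continuousAt (γ : SkorohodSpace) :
    {t : I | ¬ ContinuousAt γ.toFun t}.Countable := by
  refine ((countable_lt_of_tendsto_left γ.toFun).union
    (countable_lt_of_tendsto_left fun t => - γ t)).mono fun t ht => ?_
  obtain ⟨l, hl⟩ := γ.left_limit t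
  have h0 : 0 < t := by
    refine pos_iff_ne_zero.2 fun h => ht ?_
    subst h
    have := γ.right_continuous 0
    rwa [show Ici (0 : I) = univ from Ici_bot, continuousWithinAt_univ] at this
  rcases lt_trichotomy l (γ t) with h | h | h
  · exact Or.inl ⟨h0, l, hl, h⟩
  · refine absurd (continuousAt_iff_continuous_left'_right'.2 ⟨?_, ?_⟩) ht
    · rw [h] at hl
      exact hl
    · exact (γ.right_continuous t).mono Ioi_subset_Ici_self
  · exact Or.inr ⟨h0, -l, hl.neg, neg_lt_neg h⟩

/-- The path `γ + c δ`. -/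
noncomputable def addSMul (γ : SkorohodSpace) (c : ℝ) (δ : SkorohodSpace) : SkorohodSpace where
  toFun t := γ t + c * δ t
  right_continuous t :=
    (γ.right_continuous t).add (continuousWithinAt_const.mul (δ.right_continuous t))
  left_limit t := by
    obtain ⟨l, hl⟩ := γ.left_limit t
    obtain ⟨k, hk⟩ := δ.left_limit t
    exact ⟨_, hl.add (hk.const_mul c)⟩

@[simp] lemma addSMul_apply (γ : SkorohodSpace) (c : ℝ) (δ : SkorohodSpace) (t : I) :
    addSMul γ c δ t = γ t + c * δ t := rfl

/-! ### Running infimum and reflection -/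

lemma bddBelow_range (γ : SkorohodSpace) (s : Set I) : BddBelow (range fun u : s => γ u) := by
  obtain ⟨C, hC⟩ := γ.exists_bound
  exact ⟨-C, by rintro _ ⟨u, rfl⟩; exact (abs_le.1 (hC u)).1⟩

/-- The running infimum `inf_{s ≤ t} γ s`. -/
noncomputable def runningInf (γ : SkorohodSpace) (t : I) : ℝ := ⨅ s : Iic t, γ s

lemma runningInf_le (γ : SkorohodSpace) {s t : I} (h : s ≤ t) : γ.runningInf t ≤ γ s :=
  ciInf_le (γ.bddBelow_range (Iic t)) (⟨s, h⟩ : Iic t)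

lemma le_runningInf (γ : SkorohodSpace) {t : I} {c : ℝ} (h : ∀ s ≤ t, c ≤ γ s) :
    c ≤ γ.runningInf t := by
  have : Nonempty (Iic t) := ⟨⟨t, mem_Iic.2 le_rfl⟩⟩
  exact le_ciInf fun s => h s s.2

lemma antitone_runningInf (γ : SkorohodSpace) : Antitone γ.runningInf :=
  fun _ _ hst => γ.le_runningInf fun _ hu => γ.runningInf_le (hu.trans hst)

/-- The running infimum as a càdlàg path. -/
noncomputable def runningInfPath (γ : SkorohodSpace) : SkorohodSpace where
  toFun := γ.runningInf
  right_continuous t := by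
    refine Metric.continuousWithinAt_iff'.2 fun ε hε => ?_
    have h : ∀ᶠ s in 𝓝[≥] t, γ t - ε / 2 < γ s :=
      (γ.right_continuous t).eventually_const_lt (by linarith)
    rcases eq_or_lt_of_le (unitInterval.le_one' : t ≤ 1) with rfl | ht
    · filter_upwards [self_mem_nhdsWithin] with s hs
      rw [le_antisymm unitInterval.le_one' hs, dist_self]
      exact hε
    obtain ⟨u, hu, hsub⟩ := (mem_nhdsGE_iff_exists_Ico_subset' ht).1 h
    filter_upwards [Ico_mem_nhdsGE hu] with s hs
    rw [Real.dist_eq, abs_sub_comm, abs_of_nonneg (sub_nonneg.2 (γ.antitone_runningInf hs.1))]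
    have : γ.runningInf t - ε / 2 ≤ γ.runningInf s := by
      refine γ.le_runningInf fun v hv => ?_
      rcases le_total v t with hvt | hvt
      · linarith [γ.runningInf_le hvt]
      · have h1 : γ t - ε / 2 < γ v := hsub ⟨hvt, hv.trans_lt hs.2⟩
        linarith [γ.runningInf_le (le_refl t)]
    linarith
  left_limit t := ⟨_, γ.antitone_runningInf.tendsto_nhdsLT t⟩

lemma reflect_eq (γ : SkorohodSpace) (t : I) : reflect γ t = γ t - γ.runningInf t := by
  have : Nonempty (Iic t) := ⟨⟨t, mem_Iic.2 le_rfl⟩⟩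
  refine le_antisymm (ciSup_le fun s => ?_) ?_
  · linarith [γ.runningInf_le s.2]
  · have hb : BddAbove (range fun s : Iic t => γ t - γ s) :=
      ⟨γ t - γ.runningInf t, by rintro _ ⟨s, rfl⟩; linarith [γ.runningInf_le s.2]⟩
    have : γ t - reflect γ t ≤ γ.runningInf t := γ.le_runningInf fun s hs => by
      have : γ t - γ s ≤ reflect γ t := le_ciSup hb (⟨s, hs⟩ : Iic t)
      linarith
    linarith

/-- The reflection of `γ` as a càdlàg path. -/
noncomputable def reflectPath (γ : SkorohodSpace) : SkorohodSpace := γ.addSMul (-1) γ.runningInfPath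

lemma reflectPath_apply (γ : SkorohodSpace) (t : I) : γ.reflectPath t = reflect γ t := by
  rw [reflect_eq]
  show γ t + -1 * γ.runningInf t = _
  ring

lemma reflect_nonneg (γ : SkorohodSpace) (t : I) : 0 ≤ reflect γ t := by
  rw [reflect_eq]
  linarith [γ.runningInf_le (le_refl t)]

lemma sub_le_reflect (γ : SkorohodSpace) {s t : I} (h : s ≤ t) : γ t - γ s ≤ reflect γ t := by
  rw [reflect_eq]
  linarith [γ.runningInf_le h]

lemma reflect_le (γ : SkorohodSpace) {t : I} {c : ℝ} (h : ∀ s ≤ t, γ t - γ s ≤ c) :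
    reflect γ t ≤ c := by
  have : Nonempty (Iic t) := ⟨⟨t, mem_Iic.2 le_rfl⟩⟩
  exact ciSup_le fun s => h s s.2

/-! ### Supremum norm and time changes -/

/-- The supremum norm of a path. -/
noncomputable def supNorm (γ : SkorohodSpace) : ℝ := ⨆ t, |γ t|

lemma abs_le_supNorm (γ : SkorohodSpace) (t : I) : |γ t| ≤ γ.supNorm := by
  obtain ⟨C, hC⟩ := γ.exists_bound
  exact le_ciSup (f := fun t => |γ t|) ⟨C, by rintro _ ⟨u, rfl⟩; exact hC u⟩ t

lemma supNorm_le (γ : SkorohodSpace) {c : ℝ} (h : ∀ t, |γ t| ≤ c) : γ.supNorm ≤ c := ciSup_le h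

lemma supNorm_nonneg (γ : SkorohodSpace) : 0 ≤ γ.supNorm :=
  (abs_nonneg _).trans (γ.abs_le_supNorm 0)

lemma reflect_le_supNorm (γ : SkorohodSpace) (t : I) : reflect γ t ≤ 2 * γ.supNorm :=
  γ.reflect_le fun s _ => by
    linarith [(abs_le.1 (γ.abs_le_supNorm t)).2, (abs_le.1 (γ.abs_le_supNorm s)).1]

lemma exists_timeChange {φ ψ : SkorohodSpace} {ε : ℝ} (h : edist φ ψ < ENNReal.ofReal ε) :
    ∃ lam : I ≃o I, (∀ t, |φ (lam t) - ψ t| < ε) ∧ ∀ t, |(lam t : ℝ) - t| < ε := by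
  obtain ⟨lam, hlam⟩ := iInf_lt_iff.1 (show (⨅ lam : I ≃o I, cost φ ψ lam) < _ from h)
  obtain ⟨h1, h2⟩ := max_lt_iff.1 (show max _ _ < _ from hlam)
  refine ⟨lam, fun t => ?_, fun t => ?_⟩
  · have := (le_iSup (fun t => edist (φ (lam t)) (ψ t)) t).trans_lt h1
    rw [edist_dist, ENNReal.ofReal_lt_ofReal_iff_of_nonneg dist_nonneg, Real.dist_eq] at this
    exact this
  · have := (le_iSup (fun t => edist (lam t) t) t).trans_lt h2
    rw [edist_dist, ENNReal.ofReal_lt_ofReal_iff_of_nonneg dist_nonneg, Subtype.dist_eq,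
      Real.dist_eq] at this
    exact this

lemma supNorm_le_of_edist_lt {φ ψ : SkorohodSpace} {ε : ℝ} (h : edist φ ψ < ENNReal.ofReal ε) :
    φ.supNorm ≤ ψ.supNorm + ε := by
  obtain ⟨lam, h1, -⟩ := exists_timeChange h
  refine φ.supNorm_le fun t => ?_
  have := h1 (lam.symm t)
  rw [lam.apply_symm_apply] at this
  have h3 := abs_sub_abs_le_abs_sub (φ t) (ψ (lam.symm t))
  linarith [ψ.abs_le_supNorm (lam.symm t)]

/-- An increasing time change carries `{s ≤ t}` onto `{s ≤ lam t}`, so the two suprema run over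
matching increments, each of which is off by less than `2 ε`. -/
lemma abs_reflect_sub_le {φ ψ : SkorohodSpace} {ε : ℝ} {lam : I ≃o I}
    (h : ∀ t, |φ (lam t) - ψ t| < ε) (t : I) : |reflect φ (lam t) - reflect ψ t| ≤ 2 * ε := by
  rw [abs_le]
  have ht := abs_lt.1 (h t)
  constructor
  · have : reflect ψ t ≤ reflect φ (lam t) + 2 * ε := ψ.reflect_le fun s hs => by
      have := φ.sub_le_reflect (lam.monotone hs)
      have h2 := abs_lt.1 (h s)
      linarith
    linarith
  · have : reflect φ (lam t) ≤ reflect ψ t + 2 * ε := φ.reflect_le fun s hs => by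
      have := ψ.sub_le_reflect (lam.symm_apply_le.2 hs)
      have h2 := abs_lt.1 (h (lam.symm s))
      rw [lam.apply_symm_apply] at h2
      linarith
    linarith

lemma continuous_supNorm : Continuous supNorm := by
  refine continuous_iff_continuousAt.2 fun ψ => Metric.tendsto_nhds.2 fun ε hε => ?_
  filter_upwards [Metric.eball_mem_nhds ψ (ENNReal.ofReal_pos.2 (half_pos hε))] with φ hφ
  have h1 := supNorm_le_of_edist_lt hφ
  rw [Metric.mem_eball, edist_comm] at hφ
  have h2 := supNorm_le_of_edist_lt hφ
  rw [Real.dist_eq, abs_lt]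
  constructor <;> linarith

end SkorohodSpace

/-! ### Primitives and continuity of the contraction map -/

namespace SkorohodSpace

lemma measurable_comp_projIcc (h : SkorohodSpace) :
    Measurable fun r : ℝ => h (projIcc 0 1 zero_le_one r) :=
  h.measurable.comp continuous_projIcc.measurable

lemma intervalIntegrable (h : SkorohodSpace) (a b : ℝ) :
    IntervalIntegrable (fun r => h (projIcc 0 1 zero_le_one r)) volume a b := by
  refine (intervalIntegrable_const (c := h.supNorm)).mono_fun
    h.measurable_comp_projIcc.aestronglyMeasurable (Eventually.of_forall fun r => ?_)
  simp only [Real.norm_eq_abs]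
  exact (h.abs_le_supNorm _).trans (le_abs_self _)

/-- The primitive `t ↦ ∫_0^t h` of a càdlàg path. -/
noncomputable def primitive (h : SkorohodSpace) : C(I, ℝ) where
  toFun t := ∫ r in (0 : ℝ)..t, h (projIcc 0 1 zero_le_one r)
  continuous_toFun := by
    have := intervalIntegral.continuous_primitive
      (μ := volume) (f := fun r => h (projIcc 0 1 zero_le_one r)) (h.intervalIntegrable) 0
    exact this.comp continuous_subtype_val

lemma reflectsTo_iff (γ : SkorohodSpace) (φ : C(I, ℝ)) :
    ReflectsTo γ φ ↔ γ.reflectPath.primitive = φ := by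
  simp only [ReflectsTo, ContinuousMap.ext_iff, primitive, ContinuousMap.coe_mk, reflectPath_apply]

lemma dist_primitive_le (h k : SkorohodSpace) :
    dist h.primitive k.primitive ≤ ∫ r in (0 : ℝ)..1,
      |h (projIcc 0 1 zero_le_one r) - k (projIcc 0 1 zero_le_one r)| := by
  have hi : ∀ a b : ℝ, IntervalIntegrable (fun r =>
      |h (projIcc 0 1 zero_le_one r) - k (projIcc 0 1 zero_le_one r)|) volume a b := fun a b =>
    ((h.intervalIntegrable a b).sub (k.intervalIntegrable a b)).abs
  refine (ContinuousMap.dist_le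
    (intervalIntegral.integral_nonneg zero_le_one fun _ _ => abs_nonneg _)).2 fun t => ?_
  rw [Real.dist_eq]
  show |(∫ r in (0 : ℝ)..t, _) - ∫ r in (0 : ℝ)..t, _| ≤ _
  rw [← intervalIntegral.integral_sub (h.intervalIntegrable _ _) (k.intervalIntegrable _ _)]
  refine (intervalIntegral.abs_integral_le_integral_abs t.2.1).trans ?_
  exact intervalIntegral.integral_mono_interval le_rfl t.2.1 t.2.2
    (Eventually.of_forall fun _ => abs_nonneg _) (hi _ _)

lemma tendsto_reflect_of_continuousAt {ψ : SkorohodSpace} {r : I}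
    (hr : ContinuousAt ψ.reflectPath.toFun r) :
    Tendsto (fun φ : SkorohodSpace => reflect φ r) (𝓝 ψ) (𝓝 (reflect ψ r)) := by
  refine Metric.tendsto_nhds.2 fun ε hε => ?_
  obtain ⟨δ, hδ, hδ'⟩ := Metric.continuousAt_iff.1 hr (ε / 2) (half_pos hε)
  -- `δ` controls the displacement of time; `ε / 4` is doubled by the reflection and leaves `ε / 2`.
  have hm : 0 < min δ (ε / 4) := lt_min hδ (by positivity)
  filter_upwards [Metric.eball_mem_nhds ψ (ENNReal.ofReal_pos.2 hm)] with φ hφ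
  obtain ⟨lam, h1, h2⟩ := exists_timeChange hφ
  have h3 := abs_reflect_sub_le h1 (lam.symm r)
  have h4 := h2 (lam.symm r)
  rw [lam.apply_symm_apply] at h3 h4
  have h5 : |reflect ψ (lam.symm r) - reflect ψ r| < ε / 2 := by
    have : dist (lam.symm r) r < δ := by
      rw [Subtype.dist_eq, Real.dist_eq, abs_sub_comm]
      exact h4.trans_le (min_le_left _ _)
    have := hδ' this
    rwa [Real.dist_eq, reflectPath_apply, reflectPath_apply] at this
  rw [Real.dist_eq]
  have h6 : 2 * min δ (ε / 4) ≤ ε / 2 := by linarith [min_le_right δ (ε / 4)]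
  calc |reflect φ r - reflect ψ r|
      ≤ |reflect φ r - reflect ψ (lam.symm r)| + |reflect ψ (lam.symm r) - reflect ψ r| :=
        abs_sub_le _ _ _
    _ < ε := by linarith

lemma continuous_primitive_reflectPath :
    Continuous fun γ : SkorohodSpace => γ.reflectPath.primitive := by
  refine continuous_iff_continuousAt.2 fun ψ => tendsto_iff_dist_tendsto_zero.2 ?_
  refine squeeze_zero (fun _ => dist_nonneg) (fun φ => dist_primitive_le _ _) ?_
  suffices h : Tendsto (fun φ : SkorohodSpace => ∫ r in (0 : ℝ)..1,
      |φ.reflectPath (projIcc 0 1 zero_le_one r) - ψ.reflectPath (projIcc 0 1 zero_le_one r)|)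
      (𝓝 ψ) (𝓝 (∫ _ in (0 : ℝ)..1, (0 : ℝ))) by
    rwa [intervalIntegral.integral_zero] at h
  refine intervalIntegral.tendsto_integral_filter_of_dominated_convergence
    -- At distance less than 1 the norm grows by at most 1, so both reflections lie in `[0, 2 ‖ψ‖ +
    -- 2]`; this dominating constant is generous.
    (fun _ => 4 * ψ.supNorm + 2) ?_ ?_ intervalIntegrable_const ?_
  · refine Eventually.of_forall fun φ => Measurable.aestronglyMeasurable ?_
    exact (φ.reflectPath.measurable_comp_projIcc.sub ψ.reflectPath.measurable_comp_projIcc).abs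
  · filter_upwards [Metric.eball_mem_nhds ψ (ENNReal.ofReal_pos.2 one_pos)] with φ hφ
    refine Eventually.of_forall fun r _ => ?_
    have h1 := supNorm_le_of_edist_lt hφ
    rw [Real.norm_eq_abs, abs_abs, reflectPath_apply, reflectPath_apply, abs_le]
    have a1 := φ.reflect_nonneg (projIcc 0 1 zero_le_one r)
    have a2 := φ.reflect_le_supNorm (projIcc 0 1 zero_le_one r)
    have b1 := ψ.reflect_nonneg (projIcc 0 1 zero_le_one r)
    have b2 := ψ.reflect_le_supNorm (projIcc 0 1 zero_le_one r)
    have c1 := ψ.supNorm_nonneg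
    constructor <;> linarith
  · have hc := (ψ.reflectPath.countable_not_continuousAt.image ((↑) : I → ℝ)).ae_notMem volume
    filter_upwards [hc] with r hr hr1
    rw [uIoc_of_le zero_le_one] at hr1
    have hrI : r ∈ Icc (0 : ℝ) 1 := ⟨hr1.1.le, hr1.2⟩
    have hcont : ContinuousAt ψ.reflectPath.toFun ⟨r, hrI⟩ := by
      by_contra h
      exact hr ⟨⟨r, hrI⟩, h, rfl⟩
    have h2 := tendsto_reflect_of_continuousAt hcont
    have h3 : Tendsto (fun φ : SkorohodSpace =>
        |reflect φ ⟨r, hrI⟩ - reflect ψ ⟨r, hrI⟩|) (𝓝 ψ) (𝓝 0) := by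
      simpa using (h2.sub_const (reflect ψ ⟨r, hrI⟩)).abs
    simpa only [reflectPath_apply, projIcc_of_mem zero_le_one hrI] using h3

end SkorohodSpace

/-! ### The simulated mean path and the contracted walk -/

/-- Together with `exists_lindley_eq` this gives `W k = max_{j ≤ k} (S k - S j)` for the partial
sums `S`: the recursion is the reflection of the walk. -/
lemma sum_sub_sum_le_lindley (X : ℕ → ℝ) {j k : ℕ} (h : j ≤ k) :
    ∑ i ∈ Finset.range k, X i - ∑ i ∈ Finset.range j, X i ≤ lindley X k := by
  induction k, h using Nat.le_induction with
  | base =>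
    rw [sub_self]
    cases j with
    | zero => exact le_rfl
    | succ j => exact le_max_right _ _
  | succ k _ ih =>
    rw [Finset.sum_range_succ]
    exact le_trans (by linarith) (le_max_left _ _)

lemma exists_lindley_eq (X : ℕ → ℝ) (k : ℕ) :
    ∃ j ≤ k, lindley X k = ∑ i ∈ Finset.range k, X i - ∑ i ∈ Finset.range j, X i := by
  induction k with
  | zero => exact ⟨0, le_rfl, by simp [lindley]⟩
  | succ k ih =>
    obtain ⟨j, hj, h⟩ := ih
    rcases le_total (lindley X k + X k) 0 with h0 | h0
    · exact ⟨k + 1, le_rfl, by rw [sub_self]; exact max_eq_right h0⟩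
    · refine ⟨j, hj.trans k.le_succ, ?_⟩
      rw [Finset.sum_range_succ]
      refine (max_eq_left h0).trans ?_
      linarith

lemma lindley_nonneg (X : ℕ → ℝ) (k : ℕ) : 0 ≤ lindley X k := by
  cases k with
  | zero => exact le_rfl
  | succ k => exact le_max_right _ _

/-- The grid point `j / n` of `[0,1]`. -/
noncomputable def gridPoint (n j : ℕ) (h : j ≤ n) : I :=
  ⟨(j : ℝ) / n, by positivity, div_le_one_of_le₀ (by exact_mod_cast h) (Nat.cast_nonneg n)⟩

lemma floor_gridPoint {n j : ℕ} (hn : 0 < n) (h : j ≤ n) :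
    ⌊(n : ℝ) * gridPoint n j h⌋₊ = j := by
  have hn' : (n : ℝ) ≠ 0 := by exact_mod_cast hn.ne'
  rw [show (n : ℝ) * (gridPoint n j h : ℝ) = j from mul_div_cancel₀ _ hn', Nat.floor_natCast]

lemma floor_mul_le (n : ℕ) (t : I) : ⌊(n : ℝ) * t⌋₊ ≤ n :=
  Nat.floor_le_of_le (mul_le_of_le_one_right (Nat.cast_nonneg n) t.2.2)

lemma reflect_walkPath (X : ℕ → ℝ) {n : ℕ} (hn : 0 < n) (t : I) :
    reflect (walkPath X n) t = (1 / (n : ℝ)) * lindley X ⌊(n : ℝ) * t⌋₊ := by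
  have hn' : (0 : ℝ) < n := by exact_mod_cast hn
  refine le_antisymm ((walkPath X n).reflect_le fun s hs => ?_) ?_
  · have hle : ⌊(n : ℝ) * s⌋₊ ≤ ⌊(n : ℝ) * t⌋₊ :=
      Nat.floor_le_floor (mul_le_mul_of_nonneg_left (by exact_mod_cast hs) hn'.le)
    show (1 / (n : ℝ)) * _ - (1 / (n : ℝ)) * _ ≤ _
    rw [← mul_sub]
    exact mul_le_mul_of_nonneg_left (sum_sub_sum_le_lindley X hle) (by positivity)
  · obtain ⟨j, hj, h⟩ := exists_lindley_eq X ⌊(n : ℝ) * t⌋₊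
    have hjn : j ≤ n := hj.trans (floor_mul_le n t)
    have hs : gridPoint n j hjn ≤ t := by
      refine Subtype.coe_le_coe.1 (show (j : ℝ) / n ≤ t from ?_)
      rw [div_le_iff₀ hn', mul_comm]
      exact (Nat.le_floor_iff (mul_nonneg hn'.le t.2.1)).1 hj
    refine le_trans (le_of_eq ?_) ((walkPath X n).sub_le_reflect hs)
    show _ = (1 / (n : ℝ)) * _ - (1 / (n : ℝ)) * _
    rw [← mul_sub, floor_gridPoint hn, h]

/-- Both sides vanish at `0`, are continuous and have the same right derivative, `w ⌊n t⌋ / n`. -/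
lemma integral_floor_step (w : ℕ → ℝ) {n : ℕ} (hn : 0 < n) (h : SkorohodSpace)
    (hw : ∀ t : I, h t = (1 / (n : ℝ)) * w ⌊(n : ℝ) * t⌋₊) (t : I) :
    h.primitive t = (1 / (n : ℝ) ^ 2) * (∑ i ∈ Finset.range ⌊(n : ℝ) * t⌋₊, w i
      + ((n : ℝ) * t - ⌊(n : ℝ) * t⌋₊) * w ⌊(n : ℝ) * t⌋₊) := by
  have hn' : (0 : ℝ) < n := by exact_mod_cast hn
  have hpoly : ∀ s : I, ∑ i ∈ Finset.range ⌊(n : ℝ) * s⌋₊, w i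
      + ((n : ℝ) * s - ⌊(n : ℝ) * s⌋₊) * w ⌊(n : ℝ) * s⌋₊
      = ∑ i ∈ Finset.range (n + 1), max 0 (min 1 ((n : ℝ) * s - i)) * w i := by
    intro s
    -- `polygon_eq` weights `w (i + 1)`, hence the shift; truncated subtraction is harmless because
    -- every index that occurs is at least 1.
    have := polygon_eq (fun i => w (i - 1)) n s
    simp only [Nat.add_sub_cancel] at this
    rw [← this]
    congr 1
    generalize ⌊(n : ℝ) * s⌋₊ = k
    rw [Finset.range_eq_Ico]
    have := Finset.sum_Ico_add' (fun i => w (i - 1)) 0 k 1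
    simp only [Nat.add_sub_cancel] at this
    rw [this]
    rfl
  set G : ℝ → ℝ := fun s => (1 / (n : ℝ) ^ 2) *
    ∑ i ∈ Finset.range (n + 1), max 0 (min 1 ((n : ℝ) * s - i)) * w i with hG
  have hGI : ∀ s : I, G s = (1 / (n : ℝ) ^ 2) * (∑ i ∈ Finset.range ⌊(n : ℝ) * s⌋₊, w i
      + ((n : ℝ) * s - ⌊(n : ℝ) * s⌋₊) * w ⌊(n : ℝ) * s⌋₊) := fun s => by rw [hpoly s]
  have hGc : Continuous G := by fun_prop
  have hG0 : G 0 = 0 := by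
    have := hGI 0
    simp only [Icc.coe_zero, mul_zero, Nat.floor_zero, Finset.range_zero, Finset.sum_empty,
      Nat.cast_zero, sub_zero, zero_mul, add_zero] at this
    exact this
  have hmain := intervalIntegral.integral_eq_sub_of_hasDeriv_right_of_le (a := 0) (b := (t : ℝ))
    (f := G) (f' := fun r => h (projIcc 0 1 zero_le_one r)) t.2.1 hGc.continuousOn ?_
    (h.intervalIntegrable _ _)
  · rw [← hGI, ← sub_zero (G t), ← hG0]
    exact hmain
  · intro x hx
    have hxI : x ∈ Icc (0 : ℝ) 1 := ⟨hx.1.le, hx.2.le.trans t.2.2⟩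
    have hx1 : x < 1 := hx.2.trans_le t.2.2
    set k := ⌊(n : ℝ) * x⌋₊ with hk
    have hkx : (k : ℝ) ≤ n * x := Nat.floor_le (mul_nonneg hn'.le hxI.1)
    have hxk : x < ((k : ℝ) + 1) / n := by
      rw [lt_div_iff₀ hn', mul_comm]
      exact Nat.lt_floor_add_one _
    have hev : G =ᶠ[𝓝[>] x] fun r => (1 / (n : ℝ) ^ 2) * (∑ i ∈ Finset.range k, w i
      + ((n : ℝ) * r - k) * w k) := by
      filter_upwards [Ioo_mem_nhdsGT (lt_min hxk hx1)] with r hr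
      have hrI : r ∈ Icc (0 : ℝ) 1 :=
        ⟨hxI.1.trans hr.1.le, (hr.2.trans_le (min_le_right _ _)).le⟩
      have hfl : ⌊(n : ℝ) * r⌋₊ = k := by
        rw [Nat.floor_eq_iff (mul_nonneg hn'.le hrI.1)]
        refine ⟨hkx.trans (mul_le_mul_of_nonneg_left hr.1.le hn'.le), ?_⟩
        have := hr.2.trans_le (min_le_left _ _)
        rwa [lt_div_iff₀ hn', mul_comm] at this
      have := hGI ⟨r, hrI⟩
      simp only [hfl] at this
      exact this
    have hval : G x = (1 / (n : ℝ) ^ 2) * (∑ i ∈ Finset.range k, w i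
      + ((n : ℝ) * x - k) * w k) := hGI ⟨x, hxI⟩
    have hd : HasDerivAt (fun r : ℝ => (1 / (n : ℝ) ^ 2) * (∑ i ∈ Finset.range k, w i
      + ((n : ℝ) * r - k) * w k)) ((1 / (n : ℝ) ^ 2) * ((n : ℝ) * 1 * w k)) x :=
      (((((hasDerivAt_id x).const_mul (n : ℝ)).sub_const (k : ℝ)).mul_const (w k)).const_add
        _).const_mul _
    refine HasDerivWithinAt.congr_of_eventuallyEq (hd.hasDerivWithinAt.congr_deriv ?_) hev hval
    rw [projIcc_of_mem zero_le_one hxI, hw, ← hk]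
    field_simp

/-- As `W 0 = 0`, the mean path uses `W 1, …, W k` and the slope `W (k + 1)` where the exact
integral uses `W 0, …, W (k - 1)` and `W k`. The difference is `n⁻²` times a convex combination of
`W k` and `W (k + 1)`, and `W j ≤ 2 n ‖xⁿ‖` for `j ≤ n`. -/
lemma abs_meanPath_sub_le (X : ℕ → ℝ) {n : ℕ} (hn : 0 < n) (t : I) :
    |meanPath X n t - (walkPath X n).reflectPath.primitive t|
      ≤ 2 * (walkPath X n).supNorm / n := by
  have hn' : (0 : ℝ) < n := by exact_mod_cast hn
  have hle : ∀ j ≤ n, lindley X j ≤ n * (2 * (walkPath X n).supNorm) := by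
    intro j hj
    have h1 := (walkPath X n).reflect_le_supNorm (gridPoint n j hj)
    rw [reflect_walkPath X hn, floor_gridPoint hn, one_div, inv_mul_le_iff₀ hn'] at h1
    exact h1
  rw [integral_floor_step (lindley X) hn _
    fun s => ((walkPath X n).reflectPath_apply s).trans (reflect_walkPath X hn s)]
  show |(1 / (n : ℝ) ^ 2) * _ + (1 / (n : ℝ) ^ 2) * _ * _ - _| ≤ _
  have h0 : (0 : ℝ) ≤ (n : ℝ) * t := mul_nonneg hn'.le t.2.1
  have h1 : (n : ℝ) * t ≤ n := mul_le_of_le_one_right hn'.le t.2.2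
  have hk := floor_mul_le n t
  have hfl := Nat.floor_le h0
  have hfr := Nat.lt_floor_add_one ((n : ℝ) * t)
  generalize (n : ℝ) * t = u at *
  generalize ⌊u⌋₊ = k at *
  have hI : ∑ i ∈ Finset.Icc 1 k, lindley X i
      = ∑ i ∈ Finset.range k, lindley X i + lindley X k := by
    have e1 : ∑ i ∈ Finset.Icc 1 k, lindley X i = ∑ i ∈ Finset.range k, lindley X (i + 1) := by
      rw [Finset.range_eq_Ico, Finset.sum_Ico_add' (lindley X) 0 k 1]
      rfl
    rw [e1, ← Finset.sum_range_succ, Finset.sum_range_succ']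
    simp [lindley]
  set N := (walkPath X n).supNorm
  have hN : 0 ≤ N := (walkPath X n).supNorm_nonneg
  have key : 0 ≤ (1 - (u - k)) * lindley X k + (u - k) * lindley X (k + 1) ∧
      (1 - (u - k)) * lindley X k + (u - k) * lindley X (k + 1) ≤ n * (2 * N) := by
    have a1 := lindley_nonneg X k
    have a2 := lindley_nonneg X (k + 1)
    have a3 := hle k hk
    refine ⟨add_nonneg (mul_nonneg (by linarith) a1) (mul_nonneg (by linarith) a2), ?_⟩
    -- If `k = n` the norm does not control `W (n + 1)`, but then `n t = n` and its weight is zero.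
    rcases hk.lt_or_eq with hlt | rfl
    · have a4 := hle (k + 1) hlt
      nlinarith
    · have : u - k = 0 := by linarith
      rw [this]
      linarith
  have e : 1 / (n : ℝ) ^ 2 * ∑ i ∈ Finset.Icc 1 k, lindley X i
      + 1 / (n : ℝ) ^ 2 * (u - k) * lindley X (k + 1)
      - 1 / (n : ℝ) ^ 2 * (∑ i ∈ Finset.range k, lindley X i + (u - k) * lindley X k)
      = 1 / (n : ℝ) ^ 2 * ((1 - (u - k)) * lindley X k + (u - k) * lindley X (k + 1)) := by
    rw [hI]; ring
  rw [e, abs_of_nonneg (mul_nonneg (by positivity) key.1)]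
  refine (mul_le_mul_of_nonneg_left key.2 (by positivity)).trans (le_of_eq ?_)
  field_simp

lemma dist_meanPath_le (X : ℕ → ℝ) {n : ℕ} (hn : 0 < n) :
    dist (meanPath X n) (walkPath X n).reflectPath.primitive ≤ 2 * (walkPath X n).supNorm / n :=
  (ContinuousMap.dist_le_iff_of_nonempty).2 fun t => by
    rw [Real.dist_eq]
    exact abs_meanPath_sub_le X hn t

/-! ### The contraction principle with exponential approximation -/

lemma ereal_coe_toNNReal {c : ℝ} (hc : 0 ≤ c) :
    (((c.toNNReal : ℝ≥0) : ℝ≥0∞) : EReal) = c := by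
  rw [EReal.coe_nnreal_eq_coe_real, Real.coe_toNNReal _ hc]

/-- Moves between the logarithmic scale of the LDP and plain bounds `p ≤ exp (-c a)`, to which union
bounds apply. -/
lemma log_div_le_iff {p : ℝ≥0∞} {a c : ℝ} (ha : 0 < a) :
    ENNReal.log p / (a : EReal) ≤ ((-c : ℝ) : EReal) ↔
      p ≤ ENNReal.ofReal (Real.exp (-(c * a))) := by
  rw [EReal.div_le_iff_le_mul (by exact_mod_cast ha) (EReal.coe_ne_top a), ← ENNReal.log_le_log_iff,
    ENNReal.log_ofReal_of_pos (Real.exp_pos _), Real.log_exp, ← EReal.coe_mul]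
  rw [show a * -c = -(c * a) by ring]

lemma le_log_div_iff {p : ℝ≥0∞} {a c : ℝ} (ha : 0 < a) :
    ((-c : ℝ) : EReal) ≤ ENNReal.log p / (a : EReal) ↔
      ENNReal.ofReal (Real.exp (-(c * a))) ≤ p := by
  rw [EReal.le_div_iff_mul_le (by exact_mod_cast ha) (EReal.coe_ne_top a), ← ENNReal.log_le_log_iff,
    ENNReal.log_ofReal_of_pos (Real.exp_pos _), Real.log_exp, ← EReal.coe_mul]
  rw [show -c * a = -(c * a) by ring]

lemma eventually_le_of_limsup_le {p : ℕ → ℝ≥0∞} {a : ℕ → ℝ} (ha : Tendsto a atTop atTop)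
    {i : ℝ≥0∞} (h : limsup (fun n => ENNReal.log (p n) / (a n : EReal)) atTop ≤ -(i : EReal))
    {c : ℝ} (hc : (c : EReal) < i) :
    ∀ᶠ n in atTop, p n ≤ ENNReal.ofReal (Real.exp (-(c * a n))) := by
  have h1 : limsup (fun n => ENNReal.log (p n) / (a n : EReal)) atTop < ((-c : ℝ) : EReal) := by
    refine h.trans_lt ?_
    rw [EReal.coe_neg]
    exact EReal.neg_lt_neg_iff.2 hc
  filter_upwards [eventually_lt_of_limsup_lt h1, ha.eventually_gt_atTop 0] with n hn hn0
  exact (log_div_le_iff hn0).1 hn.le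

lemma limsup_le_of_eventually_le {p : ℕ → ℝ≥0∞} {a : ℕ → ℝ} (ha : Tendsto a atTop atTop)
    {i : ℝ≥0∞} (h : ∀ c : ℝ, (c : EReal) < i →
      ∀ᶠ n in atTop, p n ≤ ENNReal.ofReal (Real.exp (-(c * a n)))) :
    limsup (fun n => ENNReal.log (p n) / (a n : EReal)) atTop ≤ -(i : EReal) := by
  refine EReal.le_neg_of_le_neg (EReal.ge_of_forall_gt_iff_ge.1 fun c hc => ?_)
  refine EReal.le_neg_of_le_neg ?_
  refine limsup_le_of_le (h := ?_)
  filter_upwards [h c hc, ha.eventually_gt_atTop 0] with n hn hn0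
  rw [← EReal.coe_neg]
  exact (log_div_le_iff hn0).2 hn

lemma eventually_ge_of_le_liminf {p : ℕ → ℝ≥0∞} {a : ℕ → ℝ} (ha : Tendsto a atTop atTop)
    {i : ℝ≥0∞} (h : -(i : EReal) ≤ liminf (fun n => ENNReal.log (p n) / (a n : EReal)) atTop)
    {c : ℝ} (hc : (i : EReal) < c) :
    ∀ᶠ n in atTop, ENNReal.ofReal (Real.exp (-(c * a n))) ≤ p n := by
  have h1 : ((-c : ℝ) : EReal) < liminf (fun n => ENNReal.log (p n) / (a n : EReal)) atTop := by
    refine lt_of_lt_of_le ?_ h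
    rw [EReal.coe_neg]
    exact EReal.neg_lt_neg_iff.2 hc
  filter_upwards [eventually_lt_of_lt_liminf h1, ha.eventually_gt_atTop 0] with n hn hn0
  exact (le_log_div_iff hn0).1 hn.le

lemma le_liminf_of_eventually_ge {p : ℕ → ℝ≥0∞} {a : ℕ → ℝ} (ha : Tendsto a atTop atTop)
    {i : ℝ≥0∞} (h : ∀ c : ℝ, (i : EReal) < c →
      ∀ᶠ n in atTop, ENNReal.ofReal (Real.exp (-(c * a n))) ≤ p n) :
    -(i : EReal) ≤ liminf (fun n => ENNReal.log (p n) / (a n : EReal)) atTop := by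
  refine EReal.neg_le_of_neg_le (EReal.le_of_forall_lt_iff_le.1 fun c hc => ?_)
  refine EReal.neg_le_of_neg_le ?_
  refine le_liminf_of_le (h := ?_)
  filter_upwards [h c hc, ha.eventually_gt_atTop 0] with n hn hn0
  rw [← EReal.coe_neg]
  exact (le_log_div_iff hn0).2 hn

/-- Once `a` passes both thresholds, `exp (-c a)` and the error `exp (-(c₁ + 1) a)` are each at most
half of `exp (-c₁ a)`. -/
lemma ofReal_exp_le_of_le_add {p : ℝ≥0∞} {a c c₁ : ℝ} (h1 : Real.log 2 ≤ a)
    (h2 : Real.log 2 / (c - c₁) ≤ a) (hc : 0 < c - c₁)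
    (h : ENNReal.ofReal (Real.exp (-(c₁ * a))) ≤
      p + ENNReal.ofReal (Real.exp (-((c₁ + 1) * a)))) :
    ENNReal.ofReal (Real.exp (-(c * a))) ≤ p := by
  refine le_trans ?_ (tsub_le_iff_right.2 h)
  rw [← ENNReal.ofReal_sub _ (Real.exp_pos _).le]
  refine ENNReal.ofReal_le_ofReal ?_
  have aux : ∀ x y : ℝ, Real.log 2 + x ≤ y → 2 * Real.exp x ≤ Real.exp y := fun x y hxy => by
    have := Real.exp_le_exp.2 hxy
    rwa [Real.exp_add, Real.exp_log two_pos] at this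
  rw [div_le_iff₀ hc] at h2
  have e1 := aux (-(c * a)) (-(c₁ * a)) (by linarith)
  have e2 := aux (-((c₁ + 1) * a)) (-(c₁ * a)) (by linarith)
  linarith

lemma contraction_le {E E' : Type*} (F : E → E') (J : E → ℝ≥0∞) (x : E) :
    (⨅ (x' : E) (_ : F x' = F x), J x') ≤ J x :=
  iInf_le_of_le x (iInf_le _ rfl)

section Contraction

variable {E E' : Type*} [TopologicalSpace E] [MetricSpace E'] {F : E → E'} {J : E → ℝ≥0∞}

/-- A lower semicontinuous function attains its minimum on the compact part of the fibre. Hence the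
sublevel sets of the contraction are exactly the images of those of `J`. -/
lemma IsGoodRateFunction.exists_eq_contraction (hJ : IsGoodRateFunction J) (hF : Continuous F)
    {y : E'} (hy : (⨅ (x : E) (_ : F x = y), J x) ≠ ⊤) :
    ∃ x, F x = y ∧ J x = ⨅ (x : E) (_ : F x = y), J x := by
  set i := ⨅ (x : E) (_ : F x = y), J x with hi
  obtain ⟨c, hc⟩ := ENNReal.lt_iff_exists_nnreal_btwn.1 (lt_top_iff_ne_top.2 hy)
  have hK : IsCompact ({x | J x ≤ c} ∩ F ⁻¹' {y}) :=
    (hJ.isCompact_sublevel c).inter_right (isClosed_singleton.preimage hF)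
  obtain ⟨x₁, hx₁⟩ := iInf_lt_iff.1 (hi ▸ hc.1)
  obtain ⟨hx₁y, hx₁c⟩ := iInf_lt_iff.1 hx₁
  have hne : ({x | J x ≤ c} ∩ F ⁻¹' {y}).Nonempty := ⟨x₁, hx₁c.le, hx₁y⟩
  obtain ⟨x₀, hx₀, hmin⟩ :=
    (hJ.lowerSemicontinuous.lowerSemicontinuousOn _).exists_isMinOn hne hK
  refine ⟨x₀, hx₀.2, le_antisymm (le_iInf₂ fun x hx => ?_) (iInf₂_le x₀ hx₀.2)⟩
  rcases le_total (J x) c with h | h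
  · exact hmin ⟨h, hx⟩
  · exact le_trans hx₀.1 h

lemma IsGoodRateFunction.contraction (hJ : IsGoodRateFunction J) (hF : Continuous F) :
    IsGoodRateFunction fun y => ⨅ (x : E) (_ : F x = y), J x := by
  have hK : ∀ c : ℝ≥0, IsCompact {y : E' | (⨅ (x : E) (_ : F x = y), J x) ≤ (c : ℝ≥0∞)} := by
    intro c
    convert (hJ.isCompact_sublevel c).image hF using 1
    ext y
    constructor
    · intro hy
      obtain ⟨x, hx, hxJ⟩ := hJ.exists_eq_contraction hF (ne_top_of_le_ne_top ENNReal.coe_ne_top hy)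
      exact ⟨x, hxJ.trans_le hy, hx⟩
    · rintro ⟨x, hx, rfl⟩
      exact (contraction_le F J x).trans hx
  refine ⟨lowerSemicontinuous_iff_isClosed_preimage.2 fun c => ?_, hK⟩
  induction c with
  | top => simp
  | coe c => exact (hK c).isClosed

lemma SatisfiesLDP.contraction_upper {Ω : Type*} [MeasurableSpace Ω] {P : Measure Ω}
    [IsProbabilityMeasure P] {a : ℕ → ℝ} (ha : Tendsto a atTop atTop) {Y : ℕ → Ω → E}
    {Z : ℕ → Ω → E'} (hJ : IsGoodRateFunction J) (hF : Continuous F) (h : SatisfiesLDP P Y a J)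
    (hZ : ∀ δ : ℝ, 0 < δ → ∀ c : ℝ, ∀ᶠ n in atTop,
      P {ω | δ ≤ dist (Z n ω) (F (Y n ω))} ≤ ENNReal.ofReal (Real.exp (-(c * a n))))
    {A : Set E'} (hA : IsClosed A) :
    limsup (fun n => ENNReal.log (P (Z n ⁻¹' A)) / (a n : EReal)) atTop
      ≤ -((⨅ y ∈ A, ⨅ (x : E) (_ : F x = y), J x : ℝ≥0∞) : EReal) := by
  refine limsup_le_of_eventually_le ha fun c hc => ?_
  obtain ⟨c₁, hc₁, hc₁'⟩ := EReal.exists_between_coe_real hc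
  rw [EReal.coe_lt_coe_iff] at hc₁
  -- For negative `c₁` the required bound exceeds 1, and any probability satisfies it.
  rcases lt_or_ge c₁ 0 with h0 | h0
  · filter_upwards [ha.eventually_gt_atTop 0] with n hn
    refine prob_le_one.trans ?_
    rw [ENNReal.one_le_ofReal, Real.one_le_exp_iff]
    nlinarith
  have hdisj : Disjoint {y : E' | (⨅ (x : E) (_ : F x = y), J x) ≤ (c₁.toNNReal : ℝ≥0∞)} A := by
    refine disjoint_left.2 fun y hy hyA => ?_
    have h1 : (⨅ y ∈ A, ⨅ (x : E) (_ : F x = y), J x) ≤ (c₁.toNNReal : ℝ≥0∞) :=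
      (iInf₂_le y hyA).trans hy
    refine absurd hc₁' (not_lt.2 (le_trans (EReal.coe_ennreal_le_coe_ennreal_iff.2 h1) ?_))
    exact (ereal_coe_toNNReal h0).le
  -- The compact sublevel set misses the closed set `A`, so it even misses a closed `δ`-thickening
  -- of `A`. If `Z n ∈ A`, then either `F (Y n)` lies in that thickening, at cost at least `c₁`, or
  -- the error is at least `δ`.
  obtain ⟨δ, hδ, hdisj'⟩ :=
    hdisj.exists_cthickenings ((hJ.contraction hF).isCompact_sublevel _) hA
  have hlow : (c₁ : EReal) ≤ ((⨅ x ∈ F ⁻¹' Metric.cthickening δ A, J x : ℝ≥0∞) : EReal) := by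
    have : (c₁.toNNReal : ℝ≥0∞) ≤ ⨅ x ∈ F ⁻¹' Metric.cthickening δ A, J x := by
      refine le_iInf₂ fun x hx => le_of_not_ge fun hxc => ?_
      refine disjoint_left.1 hdisj' (Metric.self_subset_cthickening _ ?_) hx
      exact (contraction_le F J x).trans hxc
    refine le_trans (le_of_eq ?_) (EReal.coe_ennreal_le_coe_ennreal_iff.2 this)
    exact (ereal_coe_toNNReal h0).symm
  -- The gap between `c` and `c₂` absorbs the factor 2 of the union bound.
  obtain ⟨c₂, hc₂, hc₂'⟩ := exists_between hc₁
  have h1 := eventually_le_of_limsup_le ha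
    (h.upper _ (Metric.isClosed_cthickening.preimage hF))
    (lt_of_lt_of_le (EReal.coe_lt_coe_iff.2 hc₂') hlow)
  filter_upwards [h1, hZ δ hδ c₂, ha.eventually_gt_atTop 0,
    ha.eventually_ge_atTop (Real.log 2 / (c₂ - c))] with n h1 h2 hn0 hn
  have hsub : Z n ⁻¹' A ⊆ Y n ⁻¹' (F ⁻¹' Metric.cthickening δ A) ∪
      {ω | δ ≤ dist (Z n ω) (F (Y n ω))} := by
    intro ω hω
    rcases le_or_gt δ (dist (Z n ω) (F (Y n ω))) with hd | hd
    · exact Or.inr hd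
    · exact Or.inl (Metric.mem_cthickening_of_dist_le _ _ _ _ hω ((dist_comm _ _).trans_le hd.le))
  refine (measure_mono hsub).trans ((measure_union_le _ _).trans ((add_le_add h1 h2).trans ?_))
  rw [← ENNReal.ofReal_add (Real.exp_pos _).le (Real.exp_pos _).le]
  refine ENNReal.ofReal_le_ofReal ?_
  rw [div_le_iff₀ (by linarith)] at hn
  rw [← two_mul, ← Real.exp_log (two_pos : (0 : ℝ) < 2), ← Real.exp_add, Real.exp_le_exp]
  linarith

/-- Near the image of an almost optimal point, `F (Y n)` falls into a half-size ball with
probability at least `exp (-c₁ a)`. An error large enough to leave `G` has the faster rate `c₁ + 1`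
and cannot cancel this. -/
lemma SatisfiesLDP.contraction_lower {Ω : Type*} [MeasurableSpace Ω] {P : Measure Ω}
    {a : ℕ → ℝ} (ha : Tendsto a atTop atTop) {Y : ℕ → Ω → E}
    {Z : ℕ → Ω → E'} (hF : Continuous F) (h : SatisfiesLDP P Y a J)
    (hZ : ∀ δ : ℝ, 0 < δ → ∀ c : ℝ, ∀ᶠ n in atTop,
      P {ω | δ ≤ dist (Z n ω) (F (Y n ω))} ≤ ENNReal.ofReal (Real.exp (-(c * a n))))
    {G : Set E'} (hG : IsOpen G) :
    -((⨅ y ∈ G, ⨅ (x : E) (_ : F x = y), J x : ℝ≥0∞) : EReal)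
      ≤ liminf (fun n => ENNReal.log (P (Z n ⁻¹' G)) / (a n : EReal)) atTop := by
  refine le_liminf_of_eventually_ge ha fun c hc => ?_
  obtain ⟨c₁, hc₁, hc₁'⟩ := EReal.exists_between_coe_real hc
  rw [EReal.coe_lt_coe_iff] at hc₁'
  have hex : ∃ x, F x ∈ G ∧ (J x : EReal) < c₁ := by
    by_contra hcon
    push Not at hcon
    have hc₁0 : 0 ≤ c₁ := by
      have := (EReal.coe_ennreal_nonneg _).trans_lt hc₁
      exact (EReal.coe_lt_coe_iff.1 this).le
    have hh : (c₁.toNNReal : ℝ≥0∞) ≤ ⨅ y ∈ G, ⨅ (x : E) (_ : F x = y), J x := by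
      refine le_iInf₂ fun y hy => le_iInf₂ fun x hx => ?_
      have := hcon x (hx ▸ hy)
      rw [← EReal.coe_ennreal_le_coe_ennreal_iff, ereal_coe_toNNReal hc₁0]
      exact this
    refine absurd hc₁ (not_lt.2 (le_trans (le_of_eq ?_)
      (EReal.coe_ennreal_le_coe_ennreal_iff.2 hh)))
    exact (ereal_coe_toNNReal hc₁0).symm
  obtain ⟨x, hxG, hxc⟩ := hex
  obtain ⟨δ, hδ, hball⟩ := Metric.isOpen_iff.1 hG _ hxG
  have hlt : ((⨅ z ∈ F ⁻¹' Metric.ball (F x) (δ / 2), J z : ℝ≥0∞) : EReal) < c₁ := by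
    refine lt_of_le_of_lt (EReal.coe_ennreal_le_coe_ennreal_iff.2 ?_) hxc
    exact biInf_le J (show x ∈ F ⁻¹' Metric.ball (F x) (δ / 2) from
      Metric.mem_ball_self (half_pos hδ))
  have hU : IsOpen (F ⁻¹' Metric.ball (F x) (δ / 2)) := Metric.isOpen_ball.preimage hF
  have h1 : ∀ᶠ n in atTop, ENNReal.ofReal (Real.exp (-(c₁ * a n))) ≤
      P (Y n ⁻¹' (F ⁻¹' Metric.ball (F x) (δ / 2))) :=
    eventually_ge_of_le_liminf ha (h.lower _ hU) hlt
  filter_upwards [h1, hZ (δ / 2) (half_pos hδ) (c₁ + 1), ha.eventually_ge_atTop (Real.log 2),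
    ha.eventually_ge_atTop (Real.log 2 / (c - c₁))] with n h1 h2 hn1 hn2
  have hsub : Y n ⁻¹' (F ⁻¹' Metric.ball (F x) (δ / 2)) ⊆ Z n ⁻¹' G ∪
      {ω | δ / 2 ≤ dist (Z n ω) (F (Y n ω))} := by
    intro ω hω
    rcases le_or_gt (δ / 2) (dist (Z n ω) (F (Y n ω))) with hd | hd
    · exact Or.inr hd
    · refine Or.inl (hball ?_)
      have h3 : dist (F (Y n ω)) (F x) < δ / 2 := hω
      have h4 := dist_triangle (Z n ω) (F (Y n ω)) (F x)
      exact Metric.mem_ball.2 (by linarith)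
  exact ofReal_exp_le_of_le_add hn1 hn2 (sub_pos.2 hc₁')
    (h1.trans ((measure_mono hsub).trans ((measure_union_le _ _).trans (add_le_add le_rfl h2))))

lemma SatisfiesLDP.contraction {Ω : Type*} [MeasurableSpace Ω] {P : Measure Ω}
    [IsProbabilityMeasure P] {a : ℕ → ℝ} (ha : Tendsto a atTop atTop) {Y : ℕ → Ω → E}
    {Z : ℕ → Ω → E'} (hJ : IsGoodRateFunction J) (hF : Continuous F) (h : SatisfiesLDP P Y a J)
    (hZ : ∀ δ : ℝ, 0 < δ → ∀ c : ℝ, ∀ᶠ n in atTop,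
      P {ω | δ ≤ dist (Z n ω) (F (Y n ω))} ≤ ENNReal.ofReal (Real.exp (-(c * a n)))) :
    SatisfiesLDP P Z a fun y => ⨅ (x : E) (_ : F x = y), J x where
  lowerSemicontinuous := (hJ.contraction hF).lowerSemicontinuous
  upper _ hA := SatisfiesLDP.contraction_upper ha hJ hF h hZ hA
  lower _ hG := SatisfiesLDP.contraction_lower ha hF h hZ hG

end Contraction

lemma contractedRate_eq (J : SkorohodSpace → ℝ≥0∞) :
    contractedRate J = fun φ => ⨅ (γ : SkorohodSpace) (_ : γ.reflectPath.primitive = φ), J γ := by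
  funext φ
  simp only [contractedRate, SkorohodSpace.reflectsTo_iff]

lemma IsGoodRateFunction.contractedRate {J : SkorohodSpace → ℝ≥0∞} (hJ : IsGoodRateFunction J) :
    IsGoodRateFunction (contractedRate J) := by
  rw [contractedRate_eq]
  exact hJ.contraction SkorohodSpace.continuous_primitive_reflectPath

/-- Goodness of the rate function makes large norms super-exponentially unlikely. -/
lemma SatisfiesLDP.exists_supNorm_tail {Ω : Type*} [MeasurableSpace Ω] {P : Measure Ω}
    {a : ℕ → ℝ} (ha : Tendsto a atTop atTop) {Y : ℕ → Ω → SkorohodSpace}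
    {J : SkorohodSpace → ℝ≥0∞} (hJ : IsGoodRateFunction J) (h : SatisfiesLDP P Y a J) (c : ℝ) :
    ∃ M : ℝ, ∀ᶠ n in atTop,
      P {ω | M ≤ (Y n ω).supNorm} ≤ ENNReal.ofReal (Real.exp (-(c * a n))) := by
  obtain ⟨M, hM⟩ := (hJ.isCompact_sublevel (|c| + 1).toNNReal).bddAbove_image
    SkorohodSpace.continuous_supNorm.continuousOn
  refine ⟨M + 1, ?_⟩
  refine eventually_le_of_limsup_le ha
    (h.upper {γ | M + 1 ≤ γ.supNorm}
      (isClosed_le continuous_const SkorohodSpace.continuous_supNorm)) ?_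
  have h1 : ((|c| + 1).toNNReal : ℝ≥0∞) ≤ ⨅ γ ∈ {γ : SkorohodSpace | M + 1 ≤ γ.supNorm}, J γ := by
    refine le_iInf₂ fun γ hγ => le_of_not_ge fun hlt => ?_
    have h2 : γ.supNorm ≤ M := hM ⟨γ, hlt, rfl⟩
    have h3 : M + 1 ≤ γ.supNorm := hγ
    linarith
  refine lt_of_lt_of_le ?_ (EReal.coe_ennreal_le_coe_ennreal_iff.2 h1)
  rw [ereal_coe_toNNReal (by positivity), EReal.coe_lt_coe_iff]
  linarith [le_abs_self c]

lemma SatisfiesLDP.meanPath {Ω : Type*} [MeasurableSpace Ω] {P : Measure Ω}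
    [IsProbabilityMeasure P] {X : ℕ → Ω → ℝ} {a : ℕ → ℝ} (ha : Tendsto a atTop atTop)
    {J : SkorohodSpace → ℝ≥0∞} (hJ : IsGoodRateFunction J)
    (h : SatisfiesLDP P (fun n ω => walkPath (fun i => X i ω) n) a J) :
    SatisfiesLDP P (fun n ω => meanPath (fun i => X i ω) n) a (ReflectedWalk.contractedRate J) := by
  rw [contractedRate_eq]
  refine SatisfiesLDP.contraction ha hJ SkorohodSpace.continuous_primitive_reflectPath h
    fun δ hδ c => ?_
  obtain ⟨M, hM⟩ := h.exists_supNorm_tail ha hJ c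
  -- For `n ≥ 2 M / δ`, an error of at least `δ` forces `‖xⁿ‖ ≥ M`.
  filter_upwards [hM, eventually_gt_atTop 0, eventually_ge_atTop ⌈2 * M / δ⌉₊] with n hn hn0 hnM
  refine (measure_mono fun ω hω => ?_).trans hn
  have h1 : δ ≤ dist _ _ := hω
  have h2 := h1.trans (dist_meanPath_le (fun i => X i ω) hn0)
  have hn0' : (0 : ℝ) < n := by exact_mod_cast hn0
  rw [le_div_iff₀ hn0'] at h2
  have h3 : 2 * M / δ ≤ n := (Nat.le_ceil _).trans (by exact_mod_cast hnM)
  rw [div_le_iff₀ hδ] at h3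
  show M ≤ _
  linarith

lemma contractedRate_eq_of_top {J : SkorohodSpace → ℝ≥0∞}
    (h : ∀ γ, ¬ HasFiniteVariation γ → J γ = ⊤) (φ : C(I, ℝ)) :
    contractedRate J φ =
      ⨅ (γ : SkorohodSpace) (_ : HasFiniteVariation γ) (_ : ReflectsTo γ φ), J γ := by
  refine iInf_congr fun γ => ?_
  by_cases hγ : HasFiniteVariation γ
  · simp [hγ]
  · simp [hγ, h γ hγ]

/-! ### Signed measures on the line -/

lemma exists_monotone_cofinal {T : Set ℝ} (hT : T.Nonempty) (hb : BddAbove T) :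
    ∃ d : ℕ → ℝ, Monotone d ∧ (∀ n, d n ∈ T) ∧ ∀ t ∈ T, ∃ n, t ≤ d n := by
  by_cases hm : sSup T ∈ T
  · exact ⟨fun _ => sSup T, monotone_const, fun _ => hm, fun t ht => ⟨0, le_csSup hb ht⟩⟩
  · obtain ⟨d, hd, hlim, hmem⟩ := exists_seq_tendsto_sSup hT hb
    refine ⟨d, hd, hmem, fun t ht => ?_⟩
    have : t < sSup T := lt_of_le_of_ne (le_csSup hb ht) fun h => hm (h ▸ ht)
    obtain ⟨n, hn⟩ := (hlim.eventually_const_lt this).exists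
    exact ⟨n, hn.le⟩

lemma exists_antitone_coinitial {T : Set ℝ} (hT : T.Nonempty) (hb : BddBelow T) :
    ∃ d : ℕ → ℝ, Antitone d ∧ (∀ n, d n ∈ T) ∧ ∀ t ∈ T, ∃ n, d n ≤ t := by
  by_cases hm : sInf T ∈ T
  · exact ⟨fun _ => sInf T, antitone_const, fun _ => hm, fun t ht => ⟨0, csInf_le hb ht⟩⟩
  · obtain ⟨d, hd, hlim, hmem⟩ := exists_seq_tendsto_sInf hT hb
    refine ⟨d, hd, hmem, fun t ht => ?_⟩
    have : sInf T < t := lt_of_le_of_ne (csInf_le hb ht) fun h => hm (h ▸ ht)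
    obtain ⟨n, hn⟩ := (hlim.eventually_lt_const this).exists
    exact ⟨n, hn.le⟩

/-- The union of the intervals with end points in `T`. -/
def hull (T : Set ℝ) : Set ℝ := {x | ∃ c ∈ T, ∃ d ∈ T, c ≤ x ∧ x ≤ d}

lemma measurableSet_hull (T : Set ℝ) : MeasurableSet (hull T) := by
  refine OrdConnected.measurableSet ⟨?_⟩
  rintro x ⟨c, hc, -, -, hcx, -⟩ y ⟨-, -, d, hd, -, hyd⟩ z hz
  exact ⟨c, hc, d, hd, hcx.trans hz.1, hz.2.trans hyd⟩

lemma subset_hull (T : Set ℝ) : T ⊆ hull T := fun x hx => ⟨x, hx, x, hx, le_rfl, le_rfl⟩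

/-- The hull is an increasing union of countably many intervals with end points in `T`, whether or
not `T` contains its bounds; continuity from below does the rest. -/
lemma signedMeasure_hull_nonpos (μ : SignedMeasure ℝ) {T : Set ℝ} (ha : BddAbove T)
    (hb : BddBelow T) (h : ∀ c ∈ T, ∀ d ∈ T, c ≤ d → μ (Icc c d) ≤ 0) : μ (hull T) ≤ 0 := by
  rcases T.eq_empty_or_nonempty with rfl | hT
  · have : hull (∅ : Set ℝ) = ∅ := by
      ext x
      simp [hull]
    rw [this, VectorMeasure.empty]
  obtain ⟨d, hd, hdT, hd'⟩ := exists_monotone_cofinal hT ha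
  obtain ⟨c, hc, hcT, hc'⟩ := exists_antitone_coinitial hT hb
  have hU : hull T = ⋃ n, Icc (c n) (d n) := by
    ext x
    refine ⟨?_, fun hx => ?_⟩
    · rintro ⟨p, hp, q, hq, hpx, hxq⟩
      obtain ⟨n, hn⟩ := hc' p hp
      obtain ⟨m, hm⟩ := hd' q hq
      exact mem_iUnion.2 ⟨max n m, (hc (le_max_left n m)).trans (hn.trans hpx),
        (hxq.trans hm).trans (hd (le_max_right n m))⟩
    · obtain ⟨n, hn⟩ := mem_iUnion.1 hx
      exact ⟨c n, hcT n, d n, hdT n, hn.1, hn.2⟩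
  have hmono : Monotone fun n => Icc (c n) (d n) :=
    fun n m hnm => Icc_subset_Icc (hc hnm) (hd hnm)
  rw [hU]
  refine le_of_tendsto (VectorMeasure.tendsto_vectorMeasure_iUnion_atTop_nat hmono
    fun n => measurableSet_Icc) (Eventually.of_forall fun n => ?_)
  rcases le_or_gt (c n) (d n) with hn | hn
  · exact h _ (hcT n) _ (hdT n) hn
  · simp [Icc_eq_empty_of_lt hn]

lemma abs_signedMeasure_le (μ : SignedMeasure ℝ) (A : Set ℝ) :
    |μ A| ≤ μ.totalVariation.real A := by
  by_cases hA : MeasurableSet A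
  · rw [μ.apply_eq_posPart_real_sub_negPart_real hA, SignedMeasure.totalVariation,
      measureReal_add_apply, abs_le]
    have h1 : 0 ≤ μ.toJordanDecomposition.posPart.real A := measureReal_nonneg
    have h2 : 0 ≤ μ.toJordanDecomposition.negPart.real A := measureReal_nonneg
    constructor <;> linarith
  · rw [μ.not_measurable hA, abs_zero]
    exact measureReal_nonneg

/-- A signed measure that is non-positive on the intervals with end points in `B` is non-positive
on `B`. -/
theorem signedMeasure_nonpos_of_Icc (μ : SignedMeasure ℝ) {B : Set ℝ} (hB : MeasurableSet B)
    (h : ∀ c ∈ B, ∀ d ∈ B, c ≤ d → μ (Icc c d) ≤ 0) : μ B ≤ 0 := by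
  refine le_of_forall_pos_le_add fun ε hε => ?_
  have hε' : ENNReal.ofReal (ε / 2) ≠ 0 := (ENNReal.ofReal_pos.2 (half_pos hε)).ne'
  obtain ⟨K, hKB, hK, hBK⟩ :=
    hB.exists_isCompact_sdiff_lt (μ := μ.totalVariation) (measure_ne_top _ _) hε'
  obtain ⟨U, hKU, hU, -, hUK⟩ :=
    hK.measurableSet.exists_isOpen_sdiff_lt (μ := μ.totalVariation) (measure_ne_top _ _) hε'
  obtain ⟨δ, hδ, hδU⟩ := hK.exists_thickening_subset_open hU hKU
  -- Cells of mesh `δ` keep each hull of `K ∩ Q n` within `δ` of `K`, hence inside `U`. The union of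
  -- the hulls thus squeezes between `K` and `U`, and up to `ε / 2` has the measure of `K`, as `B`
  -- has.
  let Q : ℤ → Set ℝ := fun n => Ico (n * δ) ((n + 1) * δ)
  let H : ℤ → Set ℝ := fun n => hull (K ∩ Q n)
  have hHQ : ∀ n, H n ⊆ Q n := by
    rintro n x ⟨c, hc, d, hd, hcx, hxd⟩
    exact ⟨hc.2.1.trans hcx, hxd.trans_lt hd.2.2⟩
  have hHm : ∀ n, MeasurableSet (H n) := fun n => measurableSet_hull _
  have hdisj : Pairwise (Function.onFun Disjoint H) := by
    intro n m hnm
    refine disjoint_left.2 fun x hx hy => hnm ?_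
    have h1 := hHQ n hx
    have h2 := hHQ m hy
    have a1 : (n : ℝ) < m + 1 := lt_of_mul_lt_mul_right (h1.1.trans_lt h2.2) hδ.le
    have a2 : (m : ℝ) < n + 1 := lt_of_mul_lt_mul_right (h2.1.trans_lt h1.2) hδ.le
    have b1 : n < m + 1 := by exact_mod_cast a1
    have b2 : m < n + 1 := by exact_mod_cast a2
    omega
  have hVm : MeasurableSet (⋃ n, H n) := MeasurableSet.iUnion hHm
  have hV : μ (⋃ n, H n) ≤ 0 := by
    refine hasSum_le (fun n => ?_) (VectorMeasure.hasSum_of_disjoint_iUnion hHm hdisj) hasSum_zero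
    refine signedMeasure_hull_nonpos μ ⟨_, fun x hx => hx.2.2.le⟩ ⟨_, fun x hx => hx.2.1⟩ ?_
    exact fun c hc d hd hcd => h c (hKB hc.1) d (hKB hd.1) hcd
  have hKV : K ⊆ ⋃ n, H n := by
    intro x hx
    refine mem_iUnion.2 ⟨⌊x / δ⌋, subset_hull _ ⟨hx, ?_, ?_⟩⟩
    · rw [← le_div_iff₀ hδ]
      exact Int.floor_le _
    · rw [← div_lt_iff₀ hδ]
      exact Int.lt_floor_add_one _
  have hVU : (⋃ n, H n) ⊆ U := by
    refine iUnion_subset fun n => ?_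
    rintro x ⟨c, hc, d, hd, hcx, hxd⟩
    refine hδU (Metric.mem_thickening_iff.2 ⟨c, hc.1, ?_⟩)
    rw [Real.dist_eq, abs_of_nonneg (by linarith)]
    have h1 := hc.2.1
    have h2 := hd.2.2
    linarith
  have e1 := μ.of_add_of_sdiff hK.measurableSet hB hKB
  have e2 := μ.of_add_of_sdiff hK.measurableSet hVm hKV
  have b1 : |μ (B \ K)| ≤ ε / 2 := by
    refine (abs_signedMeasure_le μ _).trans ?_
    exact ENNReal.toReal_le_of_le_ofReal (half_pos hε).le hBK.le
  have b2 : |μ ((⋃ n, H n) \ K)| ≤ ε / 2 := by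
    refine (abs_signedMeasure_le μ _).trans ?_
    exact ENNReal.toReal_le_of_le_ofReal (half_pos hε).le
      ((measure_mono (sdiff_subset_sdiff_left hVU)).trans hUK.le)
  have c1 := abs_le.1 b1
  have c2 := abs_le.1 b2
  linarith

lemma signedMeasure_eq_zero_of_Icc (μ : SignedMeasure ℝ) {B : Set ℝ} (hB : MeasurableSet B)
    (h : ∀ c ∈ B, ∀ d ∈ B, c ≤ d → μ (Icc c d) = 0) : μ B = 0 := by
  refine le_antisymm (signedMeasure_nonpos_of_Icc μ hB fun c hc d hd hcd => (h c hc d hd hcd).le) ?_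
  have : (-μ) B ≤ 0 := signedMeasure_nonpos_of_Icc (-μ) hB fun c hc d hd hcd => by
    rw [_root_.neg_apply, h c hc d hd hcd, neg_zero]
  rw [_root_.neg_apply] at this
  linarith

lemma signedMeasure_ext_of_Icc {μ ν : SignedMeasure ℝ}
    (h : ∀ c d, c ≤ d → μ (Icc c d) = ν (Icc c d)) : μ = ν := by
  refine VectorMeasure.ext fun B hB => ?_
  have : (μ - ν) B = 0 := signedMeasure_eq_zero_of_Icc _ hB fun c _ d _ hcd => by
    rw [_root_.sub_apply, h c d hcd, sub_self]
  rw [_root_.sub_apply] at this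
  linarith

/-! ### Lebesgue decomposition of signed measures on the line -/

/-- The singular part is the restriction of `s` to a null set. Every larger measurable null set
serves as well, so that two measures can share a carrier and single points can be added to one. -/
lemma exists_null_carrier (s : SignedMeasure ℝ) : ∃ N : Set ℝ, MeasurableSet N ∧ volume N = 0 ∧
    ∀ N' : Set ℝ, MeasurableSet N' → volume N' = 0 → N ⊆ N' → ∀ B, MeasurableSet B →
      s.singularPart volume B = s (B ∩ N') ∧ ∫ x in B, s.rnDeriv volume x = s (B \ N') := by
  obtain ⟨u, hu, h1, h2⟩ := s.mutuallySingular_singularPart volume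
  refine ⟨uᶜ, hu.compl, ?_, fun N' hN' hN0 hNN B hB => ?_⟩
  · have := h2 uᶜ le_rfl
    rwa [Measure.toENNRealVectorMeasure_apply_measurable hu.compl] at this
  have hdec : ∀ A, MeasurableSet A →
      s A = s.singularPart volume A + ∫ x in A, s.rnDeriv volume x := fun A hA => by
    nth_rw 1 [← s.singularPart_add_withDensity_rnDeriv_eq volume]
    rw [_root_.add_apply, withDensityᵥ_apply (s.integrable_rnDeriv volume) hA]
  have hz : s.singularPart volume (B \ N') = 0 :=
    h1 _ fun x hx => by_contra fun hxu => hx.2 (hNN hxu)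
  constructor
  · rw [hdec _ (hB.inter hN'), setIntegral_measure_zero _
      (measure_mono_null inter_subset_right hN0), add_zero]
    have := (s.singularPart volume).of_add_of_sdiff (hB.inter hN') hB inter_subset_left
    rw [sdiff_self_inter, hz, add_zero] at this
    exact this.symm
  · rw [hdec _ (hB.diff hN'), hz, zero_add]
    refine setIntegral_congr_set ?_
    refine (sdiff_null_ae_eq_self hN0).symm

lemma rnDeriv_nonpos_of_nonpos {s : SignedMeasure ℝ} {S : Set ℝ} (hS : MeasurableSet S)
    (h : ∀ B ⊆ S, MeasurableSet B → s B ≤ 0) : ∀ᵐ x, x ∈ S → s.rnDeriv volume x ≤ 0 := by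
  obtain ⟨N, hN, hN0, hcar⟩ := exists_null_carrier s
  rw [← ae_restrict_iff' hS]
  have : 0 ≤ᵐ[volume.restrict S] fun x => - s.rnDeriv volume x := by
    refine ae_nonneg_of_forall_setIntegral_nonneg (s.integrable_rnDeriv volume).neg.restrict
      fun B hB _ => ?_
    rw [integral_neg, Measure.restrict_restrict hB, (hcar N hN hN0 le_rfl _ (hB.inter hS)).2]
    exact neg_nonneg.2 (h _ (sdiff_subset.trans inter_subset_right) ((hB.inter hS).diff hN))
  filter_upwards [this] with x hx
  exact neg_nonneg.1 hx

lemma rnDeriv_eq_zero_of_eq_zero {s : SignedMeasure ℝ} {S : Set ℝ} (hS : MeasurableSet S)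
    (h : ∀ B ⊆ S, MeasurableSet B → s B = 0) : ∀ᵐ x, x ∈ S → s.rnDeriv volume x = 0 := by
  have h1 := rnDeriv_nonpos_of_nonpos hS fun B hBS hB => (h B hBS hB).le
  have h2 := rnDeriv_nonpos_of_nonpos (s := -s) hS fun B hBS hB => by
    rw [_root_.neg_apply, h B hBS hB, neg_zero]
  filter_upwards [h1, h2, s.rnDeriv_neg volume] with x a1 a2 a3 hx
  have := a2 hx
  rw [a3, Pi.neg_apply] at this
  linarith [a1 hx]

lemma ofReal_le_posPart_univ (s : SignedMeasure ℝ) (B : Set ℝ) :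
    ENNReal.ofReal (s B) ≤ s.toJordanDecomposition.posPart univ := by
  by_cases hB : MeasurableSet B
  · refine ENNReal.ofReal_le_of_le_toReal ?_
    rw [s.apply_eq_posPart_real_sub_negPart_real hB]
    have h1 : s.toJordanDecomposition.posPart.real B ≤ s.toJordanDecomposition.posPart.real univ :=
      measureReal_mono (subset_univ B)
    have h2 : 0 ≤ s.toJordanDecomposition.negPart.real B := measureReal_nonneg
    have h3 : s.toJordanDecomposition.posPart.real univ =
      (s.toJordanDecomposition.posPart univ).toReal := rfl
    linarith
  · simp [s.not_measurable hB]

lemma exists_posPart_univ_eq (s : SignedMeasure ℝ) : ∃ A, MeasurableSet A ∧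
    s.toJordanDecomposition.posPart univ = ENNReal.ofReal (s A) := by
  obtain ⟨i, hi, hi2, hi3, hp, -⟩ := s.toJordanDecomposition_spec
  refine ⟨i, hi, ?_⟩
  rw [hp, SignedMeasure.toMeasureOfZeroLE_apply _ _ _ MeasurableSet.univ]
  simp only [inter_univ]
  rw [ENNReal.ofReal, Real.toNNReal_of_nonneg]

/-- By the Hahn decomposition the positive mass is the largest value of the measure on a set, so it
suffices to beat `s A` by some `t B`. A non-measurable `B` has value `0` and does no harm. -/
lemma posPart_univ_le {s t : SignedMeasure ℝ}
    (h : ∀ A, MeasurableSet A → ∃ B, s A ≤ t B) :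
    s.toJordanDecomposition.posPart univ ≤ t.toJordanDecomposition.posPart univ := by
  obtain ⟨A, hA, hs⟩ := exists_posPart_univ_eq s
  obtain ⟨B, hB⟩ := h A hA
  rw [hs]
  exact (ENNReal.ofReal_le_ofReal hB).trans (ofReal_le_posPart_univ t B)

lemma negPart_univ_le {s t : SignedMeasure ℝ}
    (h : ∀ A, MeasurableSet A → ∃ B, t B ≤ s A) :
    s.toJordanDecomposition.negPart univ ≤ t.toJordanDecomposition.negPart univ := by
  rw [← JordanDecomposition.neg_posPart, ← JordanDecomposition.neg_posPart,
    ← SignedMeasure.toJordanDecomposition_neg, ← SignedMeasure.toJordanDecomposition_neg]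
  refine posPart_univ_le fun A hA => ?_
  obtain ⟨B, hB⟩ := h A hA
  exact ⟨B, by rw [_root_.neg_apply, _root_.neg_apply]; exact neg_le_neg hB⟩

/-! ### The Stieltjes measure of a path of finite variation -/

lemma eVariationOn_add_mul_le {α : Type*} [LinearOrder α] (f g : α → ℝ) (c : ℝ) (s : Set α) :
    eVariationOn (fun t => f t + c * g t) s ≤
      eVariationOn f s + ENNReal.ofReal |c| * eVariationOn g s := by
  refine iSup_le fun p => ?_
  refine le_trans ?_ (add_le_add (eVariationOn.sum_le (f := f) (n := p.1) p.2.2.1 p.2.2.2)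
    (mul_le_mul_right (eVariationOn.sum_le (f := g) (n := p.1) p.2.2.1 p.2.2.2) _))
  rw [Finset.mul_sum, ← Finset.sum_add_distrib]
  refine Finset.sum_le_sum fun i _ => (edist_add_add_le _ _ _ _).trans (add_le_add le_rfl ?_)
  rw [edist_dist, edist_dist, Real.dist_eq, Real.dist_eq, ← ENNReal.ofReal_mul (abs_nonneg c),
    ← abs_mul, mul_sub]

lemma HasFiniteVariation.addSMul {γ δ : SkorohodSpace} (hγ : HasFiniteVariation γ)
    (hδ : HasFiniteVariation δ) (c : ℝ) : HasFiniteVariation (γ.addSMul c δ) :=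
  ne_top_of_le_ne_top (ENNReal.add_ne_top.2 ⟨hγ, ENNReal.mul_ne_top ENNReal.ofReal_ne_top hδ⟩)
    (eVariationOn_add_mul_le γ.toFun δ.toFun c univ)

lemma hasFiniteVariation_of_monotone {γ : SkorohodSpace} (h : Monotone γ.toFun) :
    HasFiniteVariation γ :=
  (h.monotoneOn univ).boundedVariationOn fun t _ => γ.abs_le_supNorm t

lemma SkorohodSpace.hasFiniteVariation_runningInfPath (γ : SkorohodSpace) :
    HasFiniteVariation γ.runningInfPath := by
  have h0 : BoundedVariationOn (fun _ : I => (0 : ℝ)) univ :=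
    (monotone_const.monotoneOn univ).boundedVariationOn (C := 0) (by simp)
  have h1 : BoundedVariationOn (-γ.runningInf) univ :=
    (γ.antitone_runningInf.neg.monotoneOn univ).boundedVariationOn
      (C := γ.runningInfPath.supNorm) fun t _ =>
        (abs_neg (γ.runningInf t)).trans_le (γ.runningInfPath.abs_le_supNorm t)
  have h2 := eVariationOn_add_mul_le (fun _ : I => (0 : ℝ)) (-γ.runningInf) (-1) univ
  have h3 : (fun t => 0 + -1 * (-γ.runningInf) t) = γ.runningInfPath.toFun := by
    funext t
    simp [runningInfPath]
  rw [h3] at h2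
  exact ne_top_of_le_ne_top
    (ENNReal.add_ne_top.2 ⟨h0, ENNReal.mul_ne_top ENNReal.ofReal_ne_top h1⟩) h2

lemma extend_of_neg (γ : SkorohodSpace) {t : ℝ} (h : t < 0) : extend γ t = 0 := if_pos h

lemma extend_of_nonneg (γ : SkorohodSpace) {t : ℝ} (h : 0 ≤ t) :
    extend γ t = γ (projIcc 0 1 zero_le_one t) := if_neg (not_lt.2 h)

lemma extend_of_mem (γ : SkorohodSpace) {t : ℝ} (h : t ∈ Icc (0 : ℝ) 1) :
    extend γ t = γ ⟨t, h⟩ := by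
  rw [extend_of_nonneg γ h.1, projIcc_of_mem zero_le_one h]

lemma extend_coe (γ : SkorohodSpace) (t : I) : extend γ t = γ t := extend_of_mem γ t.2

lemma extend_of_one_le (γ : SkorohodSpace) {t : ℝ} (h : 1 ≤ t) : extend γ t = γ 1 := by
  rw [extend_of_nonneg γ (zero_le_one.trans h), projIcc_of_right_le zero_le_one h]
  rfl

lemma extend_addSMul (γ δ : SkorohodSpace) (c t : ℝ) :
    extend (γ.addSMul c δ) t = extend γ t + c * extend δ t := by
  rcases lt_or_ge t 0 with h | h
  · simp [extend_of_neg _ h]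
  · simp [extend_of_nonneg _ h]

lemma extend_nonneg {γ : SkorohodSpace} (h : ∀ t, 0 ≤ γ t) (t : ℝ) : 0 ≤ extend γ t := by
  rcases lt_or_ge t 0 with ht | ht
  · rw [extend_of_neg γ ht]
  · rw [extend_of_nonneg γ ht]
    exact h _

lemma measurable_extend (γ : SkorohodSpace) : Measurable (extend γ) :=
  Measurable.ite measurableSet_Iio measurable_const γ.measurable_comp_projIcc

lemma continuousWithinAt_extend (γ : SkorohodSpace) (t : ℝ) :
    ContinuousWithinAt (extend γ) (Ici t) t := by
  rcases lt_or_ge t 0 with h | h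
  · refine (continuousWithinAt_const (b := (0 : ℝ))).congr_of_eventuallyEq ?_ (extend_of_neg γ h)
    filter_upwards [mem_nhdsWithin_of_mem_nhds (Iio_mem_nhds h)] with s hs
    exact extend_of_neg γ hs
  · have h1 : ContinuousWithinAt (fun s => γ (projIcc 0 1 zero_le_one s)) (Ici t) t :=
      (γ.right_continuous _).comp continuous_projIcc.continuousWithinAt
        fun s hs => mem_Ici.2 (monotone_projIcc zero_le_one hs)
    exact h1.congr (fun s hs => extend_of_nonneg γ (h.trans hs)) (extend_of_nonneg γ h)

lemma tendsto_projIcc_left (t : I) (ht : 0 < t) :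
    Tendsto (projIcc (0 : ℝ) 1 zero_le_one) (𝓝[<] (t : ℝ)) (𝓝[<] t) := by
  refine tendsto_nhdsWithin_iff.2 ⟨?_, ?_⟩
  · have := (continuous_projIcc (h := zero_le_one' ℝ)).tendsto (t : ℝ)
    rw [projIcc_val] at this
    exact this.mono_left nhdsWithin_le_nhds
  · filter_upwards [Ioo_mem_nhdsLT (show (0 : ℝ) < t from ht)] with s hs
    have hsI : s ∈ Icc (0 : ℝ) 1 := ⟨hs.1.le, hs.2.le.trans t.2.2⟩
    rw [projIcc_of_mem zero_le_one hsI]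
    exact hs.2

lemma tendsto_extend_left {γ : SkorohodSpace} {t : I} (ht : 0 < t) {l : ℝ}
    (h : Tendsto γ.toFun (𝓝[<] t) (𝓝 l)) : Tendsto (extend γ) (𝓝[<] (t : ℝ)) (𝓝 l) := by
  refine (h.comp (tendsto_projIcc_left t ht)).congr' ?_
  filter_upwards [Ioo_mem_nhdsLT (show (0 : ℝ) < t from ht)] with s hs
  exact (extend_of_nonneg γ hs.1.le).symm

lemma leftLim_extend_of_nonpos (γ : SkorohodSpace) {t : ℝ} (h : t ≤ 0) :
    Function.leftLim (extend γ) t = 0 := by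
  refine leftLim_eq_of_tendsto (tendsto_const_nhds.congr' ?_)
  filter_upwards [self_mem_nhdsWithin] with s hs
  exact (extend_of_neg γ (lt_of_lt_of_le hs h)).symm

lemma leftLim_extend_of_one_le {γ : SkorohodSpace} (h1 : Tendsto γ.toFun (𝓝[<] 1) (𝓝 (γ 1)))
    {t : ℝ} (h : 1 ≤ t) : Function.leftLim (extend γ) t = γ 1 := by
  refine leftLim_eq_of_tendsto ?_
  rcases h.eq_or_lt with rfl | h
  · exact tendsto_extend_left (t := 1) one_pos h1
  · refine tendsto_const_nhds.congr' ?_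
    filter_upwards [Ioo_mem_nhdsLT h] with s hs
    exact (extend_of_one_le γ hs.1.le).symm

lemma leftLim_extend_of_continuousAt {γ : SkorohodSpace} {t : I} (ht : 0 < t)
    (h : ContinuousAt γ.toFun t) : Function.leftLim (extend γ) t = γ t :=
  leftLim_eq_of_tendsto
    (tendsto_extend_left ht (h.tendsto.mono_left nhdsWithin_le_nhds))

lemma HasFiniteVariation.tendsto_leftLim {γ : SkorohodSpace} (hγ : HasFiniteVariation γ) (t : ℝ) :
    Tendsto (ReflectedWalk.extend γ) (𝓝[<] t) (𝓝 (Function.leftLim (ReflectedWalk.extend γ) t)) :=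
  hγ.extend.tendsto_leftLim t

lemma HasFiniteVariation.stieltjes_Icc {γ : SkorohodSpace} (hγ : HasFiniteVariation γ) {c d : ℝ}
    (h : c ≤ d) : stieltjes γ (Icc c d) =
      ReflectedWalk.extend γ d - Function.leftLim (ReflectedWalk.extend γ) c := by
  rw [stieltjes, dif_pos hγ, hγ.extend.vectorMeasure_Icc h,
    ContinuousWithinAt.rightLim_eq (continuousWithinAt_extend γ d)]

lemma HasFiniteVariation.stieltjes_addSMul {γ δ : SkorohodSpace} (hγ : HasFiniteVariation γ)
    (hδ : HasFiniteVariation δ) (c : ℝ) :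
    stieltjes (γ.addSMul c δ) = stieltjes γ + c • stieltjes δ := by
  refine signedMeasure_ext_of_Icc fun a b hab => ?_
  have hl : Function.leftLim (ReflectedWalk.extend (γ.addSMul c δ)) a =
      Function.leftLim (ReflectedWalk.extend γ) a +
        c * Function.leftLim (ReflectedWalk.extend δ) a := by
    refine leftLim_eq_of_tendsto ?_
    rw [show ReflectedWalk.extend (γ.addSMul c δ) =
      fun t => ReflectedWalk.extend γ t + c * ReflectedWalk.extend δ t from
      funext (extend_addSMul γ δ c)]
    exact (hγ.tendsto_leftLim a).add ((hδ.tendsto_leftLim a).const_mul c)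
  rw [(hγ.addSMul hδ c).stieltjes_Icc hab, hl, extend_addSMul, _root_.add_apply, _root_.smul_apply,
    hγ.stieltjes_Icc hab, hδ.stieltjes_Icc hab, smul_eq_mul]
  ring

lemma HasFiniteVariation.stieltjes_Iic_zero {γ : SkorohodSpace} (hγ : HasFiniteVariation γ)
    (h0 : γ 0 = 0) {B : Set ℝ} (hB : MeasurableSet B) (hB0 : B ⊆ Iic 0) : stieltjes γ B = 0 := by
  refine signedMeasure_eq_zero_of_Icc _ hB fun c hc d hd hcd => ?_
  have hd0 : d ≤ 0 := hB0 hd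
  rw [hγ.stieltjes_Icc hcd, leftLim_extend_of_nonpos γ (hB0 hc), sub_zero]
  rcases hd0.lt_or_eq with h | rfl
  · exact extend_of_neg γ h
  · exact (extend_coe γ 0).trans h0

lemma HasFiniteVariation.stieltjes_Ici_one {γ : SkorohodSpace} (hγ : HasFiniteVariation γ)
    (h1 : Tendsto γ.toFun (𝓝[<] 1) (𝓝 (γ 1))) {B : Set ℝ} (hB : MeasurableSet B)
    (hB1 : B ⊆ Ici 1) : stieltjes γ B = 0 := by
  refine signedMeasure_eq_zero_of_Icc _ hB fun c hc d hd hcd => ?_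
  rw [hγ.stieltjes_Icc hcd, leftLim_extend_of_one_le h1 (hB1 hc), extend_of_one_le γ (hB1 hd),
    sub_self]

lemma HasFiniteVariation.leftLim_nonneg {γ : SkorohodSpace} (hγ : HasFiniteVariation γ)
    (h : ∀ t, 0 ≤ γ t) (t : ℝ) : 0 ≤ Function.leftLim (ReflectedWalk.extend γ) t :=
  ge_of_tendsto' (hγ.tendsto_leftLim t) fun s => extend_nonneg h s

/-- A non-negative path only decreases by jumps on its zero set. -/
lemma HasFiniteVariation.stieltjes_nonpos_of_zero {ψ : SkorohodSpace} (hψ : HasFiniteVariation ψ)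
    (h : ∀ t, 0 ≤ ψ t) {B : Set ℝ} (hB : MeasurableSet B)
    (hB0 : B ⊆ {s | ReflectedWalk.extend ψ s = 0}) : stieltjes ψ B ≤ 0 := by
  refine signedMeasure_nonpos_of_Icc _ hB fun c hc d hd hcd => ?_
  rw [hψ.stieltjes_Icc hcd, show ReflectedWalk.extend ψ d = 0 from hB0 hd]
  linarith [hψ.leftLim_nonneg h c]

lemma SkorohodSpace.countable_leftLim_ne (γ : SkorohodSpace) :
    {s : ℝ | s ∈ Ioo (0 : ℝ) 1 ∧ Function.leftLim (extend γ) s ≠ extend γ s}.Countable := by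
  refine (γ.countable_not_continuousAt.image ((↑) : I → ℝ)).mono ?_
  rintro s ⟨hs, hne⟩
  have hsI : s ∈ Icc (0 : ℝ) 1 := ⟨hs.1.le, hs.2.le⟩
  refine ⟨⟨s, hsI⟩, fun hc => hne ?_, rfl⟩
  rw [extend_of_mem γ hsI]
  exact leftLim_extend_of_continuousAt (t := ⟨s, hsI⟩) hs.1 hc

/-- Away from the countably many jumps, an interval in `(0,1)` with end points in the zero set has
measure `0 - 0`. So the measure vanishes on the zero set minus the jumps. -/
lemma HasFiniteVariation.acDeriv_eq_zero_of_zero {ψ : SkorohodSpace} (hψ : HasFiniteVariation ψ) :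
    ∀ᵐ s, s ∈ Ioo (0 : ℝ) 1 → ReflectedWalk.extend ψ s = 0 → acDeriv ψ s = 0 := by
  have hD := ψ.countable_leftLim_ne
  have hS : MeasurableSet ((Ioo (0 : ℝ) 1 ∩ ReflectedWalk.extend ψ ⁻¹' {0}) \
      {s : ℝ | s ∈ Ioo (0 : ℝ) 1 ∧
      Function.leftLim (ReflectedWalk.extend ψ) s ≠ ReflectedWalk.extend ψ s}) :=
    (measurableSet_Ioo.inter (measurable_extend ψ (measurableSet_singleton 0))).diff
      hD.measurableSet
  have h := rnDeriv_eq_zero_of_eq_zero (s := stieltjes ψ) hS fun B hBS hB =>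
    signedMeasure_eq_zero_of_Icc _ hB fun c hc d hd hcd => by
      have hc' := hBS hc
      have hl : Function.leftLim (ReflectedWalk.extend ψ) c = ReflectedWalk.extend ψ c :=
        by_contra fun hne => hc'.2 ⟨hc'.1.1, hne⟩
      rw [hψ.stieltjes_Icc hcd, hl, show ReflectedWalk.extend ψ c = 0 from hc'.1.2,
        show ReflectedWalk.extend ψ d = 0 from (hBS hd).1.2, sub_zero]
  filter_upwards [h, hD.ae_notMem volume] with s h1 h2 h3 h4
  exact h1 ⟨⟨h3, h4⟩, h2⟩

/-! ### The measure of a path and the measure of its reflection -/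

namespace SkorohodSpace

/-- The running infimum as a function on the line. -/
noncomputable def extInf (γ : SkorohodSpace) (t : ℝ) : ℝ :=
  γ.runningInf (projIcc 0 1 zero_le_one t)

lemma antitone_extInf (γ : SkorohodSpace) : Antitone γ.extInf :=
  fun _ _ h => γ.antitone_runningInf (monotone_projIcc zero_le_one h)

lemma extInf_of_mem (γ : SkorohodSpace) {t : ℝ} (h : t ∈ Icc (0 : ℝ) 1) :
    γ.extInf t = γ.runningInf ⟨t, h⟩ := by
  rw [extInf, projIcc_of_mem zero_le_one h]

/-- If `γ` is above its running infimum, then the latter is left continuous. -/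
lemma extInf_left_limit_le (γ : SkorohodSpace) {c l : ℝ} (hc : c ∈ Ioo (0 : ℝ) 1)
    (hlt : γ.extInf c < extend γ c) (hl : Tendsto γ.extInf (𝓝[<] c) (𝓝 l)) : l ≤ γ.extInf c := by
  have hcI : c ∈ Icc (0 : ℝ) 1 := ⟨hc.1.le, hc.2.le⟩
  rw [extend_of_mem γ hcI, extInf_of_mem γ hcI] at hlt
  rw [extInf_of_mem γ hcI]
  refine le_of_forall_gt_imp_ge_of_dense fun a ha => ?_
  obtain ⟨u, hu, hua⟩ : ∃ u ≤ (⟨c, hcI⟩ : I), γ u < min a (γ ⟨c, hcI⟩) := by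
    by_contra hcon
    push Not at hcon
    exact absurd (γ.le_runningInf hcon) (not_le.2 (lt_min ha hlt))
  have huc : (u : ℝ) < c := by
    refine lt_of_le_of_ne hu fun h => ?_
    have : u = ⟨c, hcI⟩ := Subtype.ext h
    rw [this] at hua
    exact absurd hua (not_lt.2 (min_le_right _ _))
  refine le_of_tendsto hl ?_
  filter_upwards [Ioo_mem_nhdsLT huc] with s hs
  have hsI : s ∈ Icc (0 : ℝ) 1 := ⟨u.2.1.trans hs.1.le, hs.2.le.trans hcI.2⟩
  rw [extInf_of_mem γ hsI]
  exact (γ.runningInf_le (show u ≤ ⟨s, hsI⟩ from hs.1.le)).trans (hua.le.trans (min_le_left _ _))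

/-- If `γ` is above its running infimum, then the latter is locally constant to the right. -/
lemma exists_rat_extInf_eq (γ : SkorohodSpace) {c : ℝ} (hc : c ∈ Ioo (0 : ℝ) 1)
    (hlt : γ.extInf c < extend γ c) : ∃ q : ℚ, c < q ∧ γ.extInf c = γ.extInf q := by
  have hcI : c ∈ Icc (0 : ℝ) 1 := ⟨hc.1.le, hc.2.le⟩
  have h1 := (continuousWithinAt_extend γ c).eventually_const_lt hlt
  obtain ⟨u, hu, hsub⟩ := (mem_nhdsGE_iff_exists_Ico_subset' hc.2).1 h1
  obtain ⟨q, hq1, hq2⟩ := exists_rat_btwn (lt_min (show c < u from hu) hc.2)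
  have hqI : (q : ℝ) ∈ Icc (0 : ℝ) 1 :=
    ⟨hcI.1.trans hq1.le, (hq2.trans_le (min_le_right _ _)).le⟩
  refine ⟨q, hq1, le_antisymm ?_ (γ.antitone_extInf hq1.le)⟩
  rw [extInf_of_mem γ hqI]
  refine γ.le_runningInf fun v hv => ?_
  rcases le_total (v : ℝ) c with hvc | hvc
  · rw [extInf_of_mem γ hcI]
    exact γ.runningInf_le hvc
  · have hvu : (v : ℝ) < u := lt_of_le_of_lt hv (hq2.trans_le (min_le_left _ _))
    have : γ.extInf c < extend γ v := hsub ⟨hvc, hvu⟩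
    rw [extend_coe] at this
    exact this.le

end SkorohodSpace

open SkorohodSpace

section Compare

variable {γ ψ : SkorohodSpace}

/-- Makes the difference of the two measures on `(0,1)` that of the running infimum. The hypothesis
stops short of `1` because a velocity there is a left derivative and need not see a final jump of
the reflection. -/
lemma extend_sub_extend (h : ∀ t < 1, ψ t = reflect γ t) {s : ℝ} (hs : s ∈ Ico (0 : ℝ) 1) :
    extend γ s - extend ψ s = γ.extInf s := by
  have hsI : s ∈ Icc (0 : ℝ) 1 := ⟨hs.1, hs.2.le⟩
  rw [extend_of_mem γ hsI, extend_of_mem ψ hsI, h _ (show (⟨s, hsI⟩ : I) < 1 from hs.2),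
    reflect_eq, extInf_of_mem γ hsI]
  ring

lemma tendsto_extInf_left (hγ : HasFiniteVariation γ) (hψ : HasFiniteVariation ψ)
    (h : ∀ t < 1, ψ t = reflect γ t) {c : ℝ} (hc : c ∈ Ioo (0 : ℝ) 1) :
    Tendsto γ.extInf (𝓝[<] c)
      (𝓝 (Function.leftLim (extend γ) c - Function.leftLim (extend ψ) c)) := by
  refine ((hγ.tendsto_leftLim c).sub (hψ.tendsto_leftLim c)).congr' ?_
  filter_upwards [Ioo_mem_nhdsLT hc.1] with s hs
  exact extend_sub_extend h ⟨hs.1.le, hs.2.trans hc.2⟩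

lemma stieltjes_sub_Icc (hγ : HasFiniteVariation γ) (hψ : HasFiniteVariation ψ)
    (h : ∀ t < 1, ψ t = reflect γ t) {c d : ℝ} (hc : 0 < c) (hcd : c ≤ d) (hd : d < 1) :
    (stieltjes γ - stieltjes ψ) (Icc c d) = γ.extInf d
      - (Function.leftLim (extend γ) c - Function.leftLim (extend ψ) c) := by
  rw [_root_.sub_apply, hγ.stieltjes_Icc hcd, hψ.stieltjes_Icc hcd,
    ← extend_sub_extend h ⟨hc.le.trans hcd, hd⟩]
  ring

lemma stieltjes_le_of_reflect (hγ : HasFiniteVariation γ) (hψ : HasFiniteVariation ψ)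
    (h : ∀ t < 1, ψ t = reflect γ t) {B : Set ℝ} (hB : MeasurableSet B) (hB1 : B ⊆ Ioo 0 1) :
    (stieltjes γ - stieltjes ψ) B ≤ 0 := by
  refine signedMeasure_nonpos_of_Icc _ hB fun c hc d hd hcd => ?_
  rw [stieltjes_sub_Icc hγ hψ h (hB1 hc).1 hcd (hB1 hd).2]
  have h1 := γ.antitone_extInf hcd
  have h2 : γ.extInf c ≤ Function.leftLim (extend γ) c - Function.leftLim (extend ψ) c := by
    refine ge_of_tendsto (tendsto_extInf_left hγ hψ h (hB1 hc)) ?_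
    filter_upwards [self_mem_nhdsWithin] with s hs
    exact γ.antitone_extInf (le_of_lt hs)
  linarith

lemma stieltjes_eq_of_reflect (hγ : HasFiniteVariation γ) (hψ : HasFiniteVariation ψ)
    (h : ∀ t < 1, ψ t = reflect γ t) {B : Set ℝ} (hB : MeasurableSet B)
    (hB1 : B ⊆ Ioo 0 1 ∩ {s | 0 < extend ψ s}) : (stieltjes γ - stieltjes ψ) B = 0 := by
  have hlt : ∀ s ∈ B, γ.extInf s < extend γ s := fun s hs => by
    have h1 : 0 < extend ψ s := (hB1 hs).2
    have h2 := extend_sub_extend h (Ioo_subset_Ico_self (hB1 hs).1)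
    linarith
  -- On `D q` the running infimum has the constant value `γ.extInf q`, so intervals with end points
  -- in `D q` have measure zero; left continuity of the infimum handles the left end point. These
  -- pieces overlap, so only the sign is passed to their union, and the other inequality is
  -- `stieltjes_le_of_reflect`.
  set D : ℚ → Set ℝ := fun q => B ∩ {s | s < q ∧ γ.extInf s = γ.extInf q} with hD
  have hDm : ∀ q, MeasurableSet (D q) := fun q =>
    hB.inter (measurableSet_Iio.inter
      (γ.antitone_extInf.measurable (measurableSet_singleton _)))
  have hBD : B = ⋃ q, D q := by
    refine subset_antisymm (fun s hs => ?_) (iUnion_subset fun q => inter_subset_left)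
    obtain ⟨q, hq1, hq2⟩ := γ.exists_rat_extInf_eq (hB1 hs).1 (hlt s hs)
    exact mem_iUnion.2 ⟨q, hs, hq1, hq2⟩
  have key : 0 ≤[⋃ q, D q] (stieltjes γ - stieltjes ψ) := by
    refine VectorMeasure.restrict_le_restrict_countable_iUnion _ _ hDm fun q => ?_
    refine VectorMeasure.restrict_le_restrict_of_subset_le _ _ fun A hA hAD => ?_
    refine (signedMeasure_eq_zero_of_Icc _ hA fun c hc d hd hcd => ?_).ge
    have hcB := (hB1 (hAD hc).1).1
    have hdB := (hB1 (hAD hd).1).1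
    have h1 := tendsto_extInf_left hγ hψ h hcB
    have h2 := γ.extInf_left_limit_le hcB (hlt c (hAD hc).1) h1
    have h3 : γ.extInf c ≤ Function.leftLim (extend γ) c - Function.leftLim (extend ψ) c := by
      refine ge_of_tendsto h1 ?_
      filter_upwards [self_mem_nhdsWithin] with s hs
      exact γ.antitone_extInf (le_of_lt hs)
    rw [stieltjes_sub_Icc hγ hψ h hcB.1 hcd hdB.2, (hAD hd).2.2, ← (hAD hc).2.2]
    linarith
  rw [← hBD] at key
  exact le_antisymm (stieltjes_le_of_reflect hγ hψ h hB (hB1.trans inter_subset_left))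
    (VectorMeasure.nonneg_of_zero_le_restrict _ key)

lemma acDeriv_compare (hγ : HasFiniteVariation γ) (hψ : HasFiniteVariation ψ)
    (h : ∀ t < 1, ψ t = reflect γ t) : ∀ᵐ s, s ∈ Ioo (0 : ℝ) 1 →
      (0 < extend ψ s → acDeriv γ s = acDeriv ψ s) ∧ (extend ψ s = 0 → acDeriv γ s ≤ 0) := by
  have hpos : MeasurableSet (Ioo 0 1 ∩ {s | 0 < extend ψ s}) :=
    measurableSet_Ioo.inter (measurableSet_lt measurable_const (measurable_extend ψ))
  have h1 := rnDeriv_eq_zero_of_eq_zero (s := stieltjes γ - stieltjes ψ) hpos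
    fun B hBS hB => stieltjes_eq_of_reflect hγ hψ h hB hBS
  have h2 := rnDeriv_nonpos_of_nonpos (s := stieltjes γ - stieltjes ψ) measurableSet_Ioo
    fun B hBS hB => stieltjes_le_of_reflect hγ hψ h hB hBS
  filter_upwards [h1, h2, (stieltjes γ).rnDeriv_sub (stieltjes ψ) volume,
    hψ.acDeriv_eq_zero_of_zero] with s a1 a2 a3 a4 hs
  rw [a3, Pi.sub_apply] at a1 a2
  refine ⟨fun hp => sub_eq_zero.1 (a1 ⟨hs, hp⟩), fun h0 => ?_⟩
  have := a2 hs
  have h4 : (stieltjes ψ).rnDeriv volume s = 0 := a4 hs h0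
  rw [h4, sub_zero] at this
  exact this

lemma exists_common_null_carrier (s t : SignedMeasure ℝ) : ∃ N : Set ℝ, MeasurableSet N ∧
    ∀ B, MeasurableSet B → s.singularPart volume B = s (B ∩ N) ∧
      t.singularPart volume B = t (B ∩ N) := by
  obtain ⟨N₁, h1, h1', h1''⟩ := exists_null_carrier s
  obtain ⟨N₂, h2, h2', h2''⟩ := exists_null_carrier t
  have h0 : volume (N₁ ∪ N₂) = 0 := measure_union_null h1' h2'
  exact ⟨N₁ ∪ N₂, h1.union h2, fun B hB =>
    ⟨(h1'' _ (h1.union h2) h0 subset_union_left B hB).1,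
      (h2'' _ (h1.union h2) h0 subset_union_right B hB).1⟩⟩

lemma stieltjes_inter_Ioo (hψ : HasFiniteVariation ψ) (h0 : ψ 0 = 0)
    (h1 : Tendsto ψ.toFun (𝓝[<] 1) (𝓝 (ψ 1))) {B : Set ℝ} (hB : MeasurableSet B) :
    stieltjes ψ B = stieltjes ψ (B ∩ Ioo 0 1) := by
  have e1 := (stieltjes ψ).of_add_of_sdiff (hB.inter measurableSet_Ioo) hB
    (inter_subset_left (t := Ioo (0 : ℝ) 1))
  have hm : MeasurableSet (B \ (B ∩ Ioo 0 1)) := hB.diff (hB.inter measurableSet_Ioo)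
  have e2 := (stieltjes ψ).of_add_of_sdiff (hm.inter measurableSet_Iic) hm
    (inter_subset_left (t := Iic (0 : ℝ)))
  rw [hψ.stieltjes_Iic_zero h0 (hm.inter measurableSet_Iic) inter_subset_right,
    hψ.stieltjes_Ici_one h1 (hm.diff (hm.inter measurableSet_Iic)) ?_, add_zero] at e2
  · rw [← e1, ← e2, add_zero]
  · intro x hx
    by_contra hx1
    have hx1' : x < 1 := not_le.1 hx1
    rcases le_or_gt x 0 with hx0 | hx0
    · exact hx.2 ⟨hx.1, hx0⟩
    · exact hx.1.2 ⟨hx.1.1, hx0, hx1'⟩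

/-- On its zero set the measure of `ψ` is non-positive, so positive singular mass can be tested
inside `{ψ > 0} ∩ (0,1)`, where both measures agree. The conditions at `0` and `1` exclude atoms of
`ψ` there. -/
lemma singularUp_le (hγ : HasFiniteVariation γ) (hψ : HasFiniteVariation ψ)
    (h : ∀ t < 1, ψ t = reflect γ t) (hpos : ∀ t, 0 ≤ ψ t) (h0 : ψ 0 = 0)
    (h1 : Tendsto ψ.toFun (𝓝[<] 1) (𝓝 (ψ 1))) : singularUp ψ ≤ singularUp γ := by
  obtain ⟨N, hN, hcar⟩ := exists_common_null_carrier (stieltjes γ) (stieltjes ψ)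
  have hP : MeasurableSet {s | 0 < extend ψ s} :=
    measurableSet_lt measurable_const (measurable_extend ψ)
  refine posPart_univ_le fun A hA => ⟨A ∩ (Ioo 0 1 ∩ {s | 0 < extend ψ s}), ?_⟩
  have hB : MeasurableSet (A ∩ (Ioo 0 1 ∩ {s | 0 < extend ψ s})) :=
    hA.inter (measurableSet_Ioo.inter hP)
  rw [(hcar _ hA).2, (hcar _ hB).1, stieltjes_inter_Ioo hψ h0 h1 (hA.inter hN)]
  set B := A ∩ (Ioo 0 1 ∩ {s | 0 < extend ψ s}) ∩ N with hBdef
  have hBm : MeasurableSet B := hB.inter hN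
  have hsub : B ⊆ A ∩ N ∩ Ioo 0 1 := fun x hx => ⟨⟨hx.1.1, hx.2⟩, hx.1.2.1⟩
  have hm : MeasurableSet (A ∩ N ∩ Ioo 0 1) := (hA.inter hN).inter measurableSet_Ioo
  have e1 := (stieltjes ψ).of_add_of_sdiff hBm hm hsub
  have e2 : stieltjes ψ ((A ∩ N ∩ Ioo 0 1) \ B) ≤ 0 := by
    refine hψ.stieltjes_nonpos_of_zero hpos (hm.diff hBm) fun x hx => ?_
    by_contra hne
    have : 0 < extend ψ x := lt_of_le_of_ne (extend_nonneg hpos x) (Ne.symm hne)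
    exact hx.2 ⟨⟨hx.1.1.1, hx.1.2, this⟩, hx.1.1.2⟩
  have e3 := stieltjes_eq_of_reflect hγ hψ h hBm fun x hx => hx.1.2
  rw [_root_.sub_apply] at e3
  linarith

/-- On `(0,1)` the measure of `γ` lies below that of `ψ`, and `ψ` has no mass elsewhere. -/
lemma singularDown_le (hγ : HasFiniteVariation γ) (hψ : HasFiniteVariation ψ)
    (h : ∀ t < 1, ψ t = reflect γ t) (h0 : ψ 0 = 0)
    (h1 : Tendsto ψ.toFun (𝓝[<] 1) (𝓝 (ψ 1))) : singularDown ψ ≤ singularDown γ := by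
  obtain ⟨N, hN, hcar⟩ := exists_common_null_carrier (stieltjes γ) (stieltjes ψ)
  refine negPart_univ_le fun A hA => ⟨A ∩ Ioo 0 1, ?_⟩
  rw [(hcar _ hA).2, (hcar _ (hA.inter measurableSet_Ioo)).1,
    stieltjes_inter_Ioo hψ h0 h1 (hA.inter hN), inter_right_comm]
  have := stieltjes_le_of_reflect hγ hψ h ((hA.inter hN).inter measurableSet_Ioo) inter_subset_right
  rw [_root_.sub_apply] at this
  linarith

theorem explicitRate_le_integralRate (hψ : HasFiniteVariation ψ)
    (h : ∀ t < 1, ψ t = reflect γ t) (hpos : ∀ t, 0 ≤ ψ t) (h0 : ψ 0 = 0)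
    (h1 : Tendsto ψ.toFun (𝓝[<] 1) (𝓝 (ψ 1))) (R : ℝ → ℝ≥0∞) (θdown θup : ℝ≥0∞) :
    explicitRate R θdown θup ψ ≤ integralRate R θdown θup γ := by
  by_cases hγ : HasFiniteVariation γ
  swap
  · rw [integralRate, if_neg hγ]
    exact le_top
  rw [integralRate, if_pos hγ, explicitRate]
  refine add_le_add (add_le_add ?_ (mul_le_mul_right (singularDown_le hγ hψ h h0 h1) _))
    (mul_le_mul_right (singularUp_le hγ hψ h hpos h0 h1) _)
  refine lintegral_mono_ae ?_
  rw [← Measure.restrict_congr_set Ioo_ae_eq_Icc, ae_restrict_iff' measurableSet_Ioo]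
  filter_upwards [acDeriv_compare hγ hψ h] with s hs hsI
  obtain ⟨a1, a2⟩ := hs hsI
  rcases (extend_nonneg hpos s).lt_or_eq with hs | hs
  · rw [indicator_of_mem (show s ∈ {s | 0 < extend ψ s} from hs),
      indicator_of_notMem (show s ∉ {s | extend ψ s = 0} from hs.ne'), add_zero, a1 hs]
  · rw [indicator_of_notMem (show s ∉ {s | 0 < extend ψ s} from fun h' => hs.not_lt h'),
      indicator_of_mem (show s ∈ {s | extend ψ s = 0} from hs.symm), zero_add]
    exact biInf_le R (show acDeriv γ s ∈ Iic 0 from a2 hs.symm)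

end Compare

namespace SkorohodSpace

/-! ### Step paths and the time spent at zero -/

/-- The path `1_{[a,1]}`. -/
noncomputable def stepPath (a : I) : SkorohodSpace where
  toFun := indicator (Ici a) 1
  right_continuous t := by
    rcases le_or_gt a t with h | h
    · refine (continuousWithinAt_const (b := (1 : ℝ))).congr (fun s hs => ?_) ?_
      · exact indicator_of_mem (show s ∈ Ici a from h.trans hs) _
      · exact indicator_of_mem (show t ∈ Ici a from h) _
    · refine (continuousWithinAt_const (b := (0 : ℝ))).congr_of_eventuallyEq ?_ ?_
      · filter_upwards [mem_nhdsWithin_of_mem_nhds (Iio_mem_nhds h)] with s hs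
        exact indicator_of_notMem (show s ∉ Ici a from fun h' =>
          (not_le.2 (show s < a from hs)) h') _
      · exact indicator_of_notMem (show t ∉ Ici a from not_le.2 h) _
  left_limit t := by
    rcases le_or_gt t a with h | h
    · refine ⟨0, tendsto_const_nhds.congr' ?_⟩
      filter_upwards [self_mem_nhdsWithin] with s hs
      exact (indicator_of_notMem (show s ∉ Ici a from not_le.2 (lt_of_lt_of_le hs h)) _).symm
    · refine ⟨1, tendsto_const_nhds.congr' ?_⟩
      filter_upwards [Ioo_mem_nhdsLT h] with s hs
      exact (indicator_of_mem (show s ∈ Ici a from hs.1.le) (1 : I → ℝ)).symm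

lemma stepPath_of_le {a t : I} (h : a ≤ t) : stepPath a t = 1 :=
  indicator_of_mem (show t ∈ Ici a from h) _

lemma stepPath_of_lt {a t : I} (h : t < a) : stepPath a t = 0 :=
  indicator_of_notMem (show t ∉ Ici a from not_le.2 h) _

lemma monotone_stepPath (a : I) : Monotone (stepPath a).toFun := by
  intro s t hst
  rcases le_or_gt a s with h | h
  · rw [stepPath_of_le h, stepPath_of_le (h.trans hst)]
  · rw [stepPath_of_lt h]
    exact indicator_nonneg (fun _ _ => zero_le_one) t

/-- The path with the value at `1` replaced by the left limit. -/
noncomputable def leftAtOne (h : SkorohodSpace) : SkorohodSpace :=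
  h.addSMul ((h.left_limit 1).choose - h 1) (stepPath 1)

lemma leftAtOne_of_lt (h : SkorohodSpace) {t : I} (ht : t < 1) : h.leftAtOne t = h t := by
  rw [leftAtOne, addSMul_apply, stepPath_of_lt ht, mul_zero, add_zero]

lemma tendsto_leftAtOne (h : SkorohodSpace) :
    Tendsto h.toFun (𝓝[<] 1) (𝓝 (h.leftAtOne 1)) := by
  have := (h.left_limit 1).choose_spec
  rwa [show h.leftAtOne 1 = (h.left_limit 1).choose by
    rw [leftAtOne, addSMul_apply, stepPath_of_le le_rfl]; ring]

lemma leftAtOne_nonneg {h : SkorohodSpace} (hh : ∀ t, 0 ≤ h t) (t : I) : 0 ≤ h.leftAtOne t := by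
  rcases (show t ≤ 1 from unitInterval.le_one').lt_or_eq with ht | rfl
  · rw [leftAtOne_of_lt h ht]
    exact hh t
  · have : (𝓝[<] (1 : I)).NeBot := nhdsLT_neBot_of_exists_lt ⟨0, one_pos⟩
    exact ge_of_tendsto' h.tendsto_leftAtOne hh

/-- The indicator of the zero set of a path. -/
noncomputable def zeroIndicator (ψ : SkorohodSpace) : ℝ → ℝ :=
  indicator (Icc 0 1 ∩ {s | extend ψ s = 0}) 1

lemma measurableSet_zero (ψ : SkorohodSpace) :
    MeasurableSet (Icc (0 : ℝ) 1 ∩ {s | extend ψ s = 0}) :=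
  measurableSet_Icc.inter (measurable_extend ψ (measurableSet_singleton 0))

lemma integrable_zeroIndicator (ψ : SkorohodSpace) : Integrable ψ.zeroIndicator := by
  refine (integrable_indicator_iff ψ.measurableSet_zero).2 (integrableOn_const ?_)
  exact ne_top_of_le_ne_top (by simp) (measure_mono (inter_subset_left (s := Icc (0 : ℝ) 1)))

lemma zeroIndicator_nonneg (ψ : SkorohodSpace) (s : ℝ) : 0 ≤ ψ.zeroIndicator s :=
  indicator_nonneg (fun _ _ => zero_le_one) s

lemma zeroIndicator_le_one (ψ : SkorohodSpace) (s : ℝ) : ψ.zeroIndicator s ≤ 1 :=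
  indicator_le_self' (f := (1 : ℝ → ℝ)) (fun _ _ => zero_le_one) s

/-- The time that the path spends at zero. -/
noncomputable def zeroTime (ψ : SkorohodSpace) : SkorohodSpace where
  toFun t := ∫ r in (0 : ℝ)..t, ψ.zeroIndicator r
  right_continuous _ := ((intervalIntegral.continuous_primitive
    (fun _ _ => ψ.integrable_zeroIndicator.intervalIntegrable) 0).comp
      continuous_subtype_val).continuousWithinAt
  left_limit _ := ⟨_, (((intervalIntegral.continuous_primitive
    (fun _ _ => ψ.integrable_zeroIndicator.intervalIntegrable) 0).comp
      continuous_subtype_val).tendsto _).mono_left nhdsWithin_le_nhds⟩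

lemma zeroTime_sub (ψ : SkorohodSpace) (s t : I) :
    ψ.zeroTime t - ψ.zeroTime s = ∫ r in (s : ℝ)..t, ψ.zeroIndicator r :=
  intervalIntegral.integral_interval_sub_left ψ.integrable_zeroIndicator.intervalIntegrable
    ψ.integrable_zeroIndicator.intervalIntegrable

lemma monotone_zeroTime (ψ : SkorohodSpace) : Monotone ψ.zeroTime.toFun := fun s t hst => by
  rw [← sub_nonneg, zeroTime_sub]
  exact intervalIntegral.integral_nonneg hst fun r _ => ψ.zeroIndicator_nonneg r

lemma extend_zeroTime (ψ : SkorohodSpace) (t : ℝ) :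
    extend ψ.zeroTime t = ∫ r in (0 : ℝ)..t, ψ.zeroIndicator r := by
  have hz : ∀ r ∉ Icc (0 : ℝ) 1, ψ.zeroIndicator r = 0 := fun r hr =>
    indicator_of_notMem (fun h => hr h.1) _
  rcases lt_or_ge t 0 with h | h
  · rw [extend_of_neg _ h, intervalIntegral.integral_symm, intervalIntegral.integral_of_le h.le,
      integral_Ioc_eq_integral_Ioo, setIntegral_eq_zero_of_forall_eq_zero, neg_zero]
    exact fun r hr => hz r fun h' => absurd h'.1 (not_le.2 hr.2)
  rcases le_or_gt t 1 with h1 | h1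
  · rw [extend_of_mem _ ⟨h, h1⟩]
    rfl
  · rw [extend_of_one_le _ h1.le, ← intervalIntegral.integral_add_adjacent_intervals
      (b := 1) ψ.integrable_zeroIndicator.intervalIntegrable
      ψ.integrable_zeroIndicator.intervalIntegrable, intervalIntegral.integral_of_le h1.le,
      setIntegral_eq_zero_of_forall_eq_zero, add_zero]
    · rfl
    · exact fun r hr => hz r fun h' => absurd h'.2 (not_le.2 hr.1)

lemma hasFiniteVariation_zeroTime (ψ : SkorohodSpace) : HasFiniteVariation ψ.zeroTime :=
  hasFiniteVariation_of_monotone ψ.monotone_zeroTime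

lemma stieltjes_zeroTime (ψ : SkorohodSpace) :
    stieltjes ψ.zeroTime = volume.withDensityᵥ ψ.zeroIndicator := by
  refine signedMeasure_ext_of_Icc fun c d hcd => ?_
  have hc : Continuous (extend ψ.zeroTime) := by
    rw [funext ψ.extend_zeroTime]
    exact intervalIntegral.continuous_primitive
      (fun _ _ => ψ.integrable_zeroIndicator.intervalIntegrable) 0
  rw [ψ.hasFiniteVariation_zeroTime.stieltjes_Icc hcd, hc.continuousWithinAt.leftLim_eq,
    withDensityᵥ_apply ψ.integrable_zeroIndicator measurableSet_Icc, integral_Icc_eq_integral_Ioc,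
    ← intervalIntegral.integral_of_le hcd, extend_zeroTime, extend_zeroTime]
  exact intervalIntegral.integral_interval_sub_left ψ.integrable_zeroIndicator.intervalIntegrable
    ψ.integrable_zeroIndicator.intervalIntegrable

/-- Pushing down while at zero does not change the reflected path. -/
lemma reflect_addSMul_zeroTime {ψ : SkorohodSpace} (hpos : ∀ t, 0 ≤ ψ t) (h0 : ψ 0 = 0) {y : ℝ}
    (hy : y ≤ 0) (t : I) : reflect (ψ.addSMul y ψ.zeroTime) t = ψ t := by
  refine le_antisymm (reflect_le _ fun s hs => ?_) ?_
  · rw [addSMul_apply, addSMul_apply]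
    have := mul_nonneg_of_nonpos_of_nonpos hy (sub_nonpos.2 (ψ.monotone_zeroTime hs))
    linarith [hpos s]
  -- After the last zero before `t` the time at zero stops growing. The supremum of `S` need not be
  -- attained, so a zero `u` slightly before it is used.
  let S : Set ℝ := {r | ∃ u : I, (u : ℝ) = r ∧ u ≤ t ∧ ψ u = 0}
  have hS0 : S.Nonempty := ⟨0, 0, rfl, unitInterval.nonneg', h0⟩
  have hSb : BddAbove S := ⟨t, by rintro _ ⟨u, rfl, hu, -⟩; exact hu⟩
  have hst : sSup S ≤ t := csSup_le hS0 (by rintro _ ⟨u, rfl, hu, -⟩; exact hu)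
  have hzero : ∫ r in (sSup S)..t, ψ.zeroIndicator r = 0 := by
    rw [intervalIntegral.integral_of_le hst]
    refine setIntegral_eq_zero_of_forall_eq_zero fun r hr => indicator_of_notMem (fun h => ?_) _
    have hz : extend ψ r = 0 := h.2
    rw [extend_of_mem ψ h.1] at hz
    exact absurd (le_csSup hSb ⟨⟨r, h.1⟩, rfl, hr.2, hz⟩) (not_le.2 hr.1)
  refine le_of_forall_pos_le_add fun ε hε => ?_
  -- The push between `u` and `sSup S` is at most `-y * (ε / (1 - y)) ≤ ε`; the denominator is
  -- positive even for `y = 0`.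
  obtain ⟨_, ⟨u, rfl, hut, hu0⟩, hu⟩ := exists_lt_of_lt_csSup hS0
    (show sSup S - ε / (1 - y) < sSup S by
      have : 0 < ε / (1 - y) := div_pos hε (by linarith)
      linarith)
  have hus : (u : ℝ) ≤ sSup S := le_csSup hSb ⟨u, rfl, hut, hu0⟩
  have h1 := sub_le_reflect (ψ.addSMul y ψ.zeroTime) hut
  rw [addSMul_apply, addSMul_apply, hu0] at h1
  have h2 : ψ.zeroTime t - ψ.zeroTime u ≤ ε / (1 - y) := by
    rw [zeroTime_sub, ← intervalIntegral.integral_add_adjacent_intervals (b := sSup S)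
      ψ.integrable_zeroIndicator.intervalIntegrable
      ψ.integrable_zeroIndicator.intervalIntegrable, hzero, add_zero]
    have := intervalIntegral.integral_mono_on (μ := volume) hus
      ψ.integrable_zeroIndicator.intervalIntegrable (intervalIntegrable_const (c := (1 : ℝ)))
      fun r _ => ψ.zeroIndicator_le_one r
    simp only [intervalIntegral.integral_const, smul_eq_mul, mul_one] at this
    linarith
  have h3 : -y * (ψ.zeroTime t - ψ.zeroTime u) ≤ ε := by
    have h4 : -y * (ψ.zeroTime t - ψ.zeroTime u) ≤ -y * (ε / (1 - y)) :=
      mul_le_mul_of_nonneg_left h2 (by linarith)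
    have h5 : (1 - y) * (ε / (1 - y)) = ε := mul_div_cancel₀ ε (by linarith)
    have h6 : 0 < ε / (1 - y) := div_pos hε (by linarith)
    linarith
  linarith

/-! ### Derivatives of primitives -/

lemma IccExtend_primitive (h : SkorohodSpace) {u : ℝ} (hu : u ∈ Icc (0 : ℝ) 1) :
    IccExtend zero_le_one h.primitive u = ∫ r in (0 : ℝ)..u, h (projIcc 0 1 zero_le_one r) := by
  rw [IccExtend_of_mem zero_le_one _ hu]
  rfl

lemma hasDerivWithinAt_primitive_right (h : SkorohodSpace) {t : I} (ht : t < 1) :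
    HasDerivWithinAt (IccExtend zero_le_one h.primitive) (h t) (Ici (t : ℝ)) t := by
  have hc : ContinuousWithinAt (fun r => h (projIcc 0 1 zero_le_one r)) (Ioi (t : ℝ)) t := by
    refine ContinuousWithinAt.mono (t := Ici (t : ℝ)) ?_ Ioi_subset_Ici_self
    exact (h.right_continuous _).comp continuous_projIcc.continuousWithinAt
      fun s hs => mem_Ici.2 (monotone_projIcc zero_le_one hs)
  have := intervalIntegral.integral_hasDerivWithinAt_right (s := Ici (t : ℝ)) (t := Ioi (t : ℝ))
    (h.intervalIntegrable 0 t)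
    h.measurable_comp_projIcc.stronglyMeasurable.stronglyMeasurableAtFilter hc
  simp only [projIcc_val] at this
  refine this.congr_of_eventuallyEq ?_ (h.IccExtend_primitive t.2)
  filter_upwards [Ico_mem_nhdsGE (show (t : ℝ) < 1 from ht)] with u hu
  exact h.IccExtend_primitive ⟨t.2.1.trans hu.1, hu.2.le⟩

lemma hasDerivWithinAt_primitive_left (h : SkorohodSpace) {t : I} (ht : 0 < t) {l : ℝ}
    (hl : Tendsto h.toFun (𝓝[<] t) (𝓝 l)) :
    HasDerivWithinAt (IccExtend zero_le_one h.primitive) l (Iic (t : ℝ)) t := by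
  -- The value at `t` is irrelevant to the integral: discarding a null point turns the closed left
  -- neighbourhood filter into the open one.
  have hle : 𝓝[≤] (t : ℝ) ⊓ ae volume ≤ 𝓝[<] (t : ℝ) := by
    rw [← Iic_sdiff_right, sdiff_eq, nhdsWithin_inter']
    refine inf_le_inf_left _ (le_principal_iff.2 ?_)
    exact compl_mem_ae_iff.2 (by simp)
  have := intervalIntegral.integral_hasDerivWithinAt_of_tendsto_ae_right
    (s := Iic (t : ℝ)) (t := Iic (t : ℝ)) (h.intervalIntegrable 0 t)
    h.measurable_comp_projIcc.stronglyMeasurable.stronglyMeasurableAtFilter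
    ((hl.comp (tendsto_projIcc_left t ht)).mono_left hle)
  refine this.congr_of_eventuallyEq ?_ (h.IccExtend_primitive t.2)
  filter_upwards [Ioc_mem_nhdsLE (show (0 : ℝ) < t from ht)] with u hu
  exact h.IccExtend_primitive ⟨hu.1.le, hu.2.trans t.2.2⟩

/-- The velocity at `1` is a left derivative, so the value of `h` at `1` gives way to its left
limit. -/
lemma hasVelocity_leftAtOne {h : SkorohodSpace} (hh : ∀ t, 0 ≤ h t) (hv : HasFiniteVariation h) :
    HasVelocity h.primitive h.leftAtOne where
  map_zero := intervalIntegral.integral_same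
  hasDeriv_right t ht := by
    rw [leftAtOne_of_lt h ht]
    exact h.hasDerivWithinAt_primitive_right ht
  hasDeriv_left := h.hasDerivWithinAt_primitive_left (t := 1) one_pos h.tendsto_leftAtOne
  nonneg := leftAtOne_nonneg hh
  hasFiniteVariation := hv.addSMul (hasFiniteVariation_of_monotone (monotone_stepPath 1)) _

end SkorohodSpace

open SkorohodSpace

lemma reflect_zero (γ : SkorohodSpace) : reflect γ 0 = 0 := by
  refine le_antisymm (γ.reflect_le fun s hs => ?_) (γ.reflect_nonneg 0)
  rw [le_antisymm hs unitInterval.nonneg', sub_self]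

lemma HasFiniteVariation.reflectPath {γ : SkorohodSpace} (h : HasFiniteVariation γ) :
    HasFiniteVariation γ.reflectPath :=
  h.addSMul γ.hasFiniteVariation_runningInfPath _

lemma ReflectsTo.exists_hasVelocity {γ : SkorohodSpace} {φ : C(I, ℝ)} (h : ReflectsTo γ φ)
    (hγ : HasFiniteVariation γ) :
    HasVelocity φ γ.reflectPath.leftAtOne ∧ γ.reflectPath.leftAtOne 0 = 0 := by
  obtain rfl := (γ.reflectsTo_iff φ).1 h
  refine ⟨hasVelocity_leftAtOne (fun t => ?_) hγ.reflectPath, ?_⟩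
  · rw [reflectPath_apply]
    exact γ.reflect_nonneg t
  · rw [leftAtOne_of_lt _ one_pos, reflectPath_apply, reflect_zero]

/-! ### Uniqueness of the velocity -/

section Velocity

variable {φ : C(I, ℝ)} {ψ γ : SkorohodSpace}

lemma HasVelocity.eq_reflect (hv : HasVelocity φ ψ) (h : ReflectsTo γ φ) :
    ∀ t < 1, ψ t = reflect γ t := by
  obtain rfl := (γ.reflectsTo_iff φ).1 h
  intro t ht
  rw [← reflectPath_apply]
  exact (uniqueDiffWithinAt_Ici (t : ℝ)).eq_deriv _ (hv.hasDeriv_right t ht)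
    (γ.reflectPath.hasDerivWithinAt_primitive_right ht)

lemma HasVelocity.primitive_eq (hv : HasVelocity φ ψ) : ψ.primitive = φ := by
  refine ContinuousMap.ext fun t => ?_
  have := intervalIntegral.integral_eq_sub_of_hasDeriv_right_of_le (a := 0) (b := (t : ℝ))
    (f := IccExtend zero_le_one φ) (f' := fun r => ψ (projIcc 0 1 zero_le_one r)) t.2.1
    (φ.continuous.Icc_extend' (h := zero_le_one)).continuousOn (fun x hx => ?_)
    (ψ.intervalIntegrable _ _)
  · rw [IccExtend_of_mem zero_le_one _ t.2, IccExtend_left] at this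
    refine this.trans ?_
    rw [show φ ⟨0, left_mem_Icc.2 zero_le_one⟩ = 0 from hv.map_zero, sub_zero]
  · have hxI : x ∈ Icc (0 : ℝ) 1 := ⟨hx.1.le, hx.2.le.trans t.2.2⟩
    have := hv.hasDeriv_right ⟨x, hxI⟩ (show (⟨x, hxI⟩ : I) < 1 from hx.2.trans_le t.2.2)
    rw [projIcc_of_mem zero_le_one hxI]
    exact this.mono Ioi_subset_Ici_self

lemma HasVelocity.tendsto_one (hv : HasVelocity φ ψ) :
    Tendsto ψ.toFun (𝓝[<] 1) (𝓝 (ψ 1)) := by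
  obtain ⟨l, hl⟩ := ψ.left_limit 1
  have h1 := ψ.hasDerivWithinAt_primitive_left (t := 1) one_pos hl
  rw [hv.primitive_eq] at h1
  have : ψ 1 = l := (uniqueDiffWithinAt_Iic (1 : ℝ)).eq_deriv _ hv.hasDeriv_left h1
  rwa [this]

end Velocity

/-! ### The variational formula -/

lemma contractedRate_le (J : SkorohodSpace → ℝ≥0∞) {γ : SkorohodSpace} {φ : C(I, ℝ)}
    (h : ReflectsTo γ φ) : contractedRate J φ ≤ J γ := iInf_le_of_le γ (iInf_le _ h)


lemma singularPart_withDensity_eq_zero (f : ℝ → ℝ) :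
    SignedMeasure.singularPart (volume.withDensityᵥ f) volume = 0 :=
  (SignedMeasure.eq_singularPart 0 f VectorMeasure.MutuallySingular.zero_left
    (by rw [zero_add])).symm

lemma rnDeriv_withDensity_ae_eq {f : ℝ → ℝ} (hf : Integrable f) :
    f =ᵐ[volume] SignedMeasure.rnDeriv (volume.withDensityᵥ f) volume :=
  SignedMeasure.eq_rnDeriv 0 f hf VectorMeasure.MutuallySingular.zero_left (by rw [zero_add])

section Formula

variable {ψ : SkorohodSpace}

lemma singularPart_addSMul_zeroTime (hψ : HasFiniteVariation ψ) (y : ℝ) :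
    (stieltjes (ψ.addSMul y ψ.zeroTime)).singularPart volume =
      (stieltjes ψ).singularPart volume := by
  rw [hψ.stieltjes_addSMul ψ.hasFiniteVariation_zeroTime, SignedMeasure.singularPart_add,
    SignedMeasure.singularPart_smul, stieltjes_zeroTime, singularPart_withDensity_eq_zero,
    smul_zero, add_zero]

lemma acDeriv_addSMul_zeroTime (hψ : HasFiniteVariation ψ) (y : ℝ) :
    ∀ᵐ s, acDeriv (ψ.addSMul y ψ.zeroTime) s = acDeriv ψ s + y * ψ.zeroIndicator s := by
  have h1 := (stieltjes ψ).rnDeriv_add (y • stieltjes ψ.zeroTime) volume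
  have h2 := (stieltjes ψ.zeroTime).rnDeriv_smul volume y
  have h3 := rnDeriv_withDensity_ae_eq ψ.integrable_zeroIndicator
  rw [← stieltjes_zeroTime] at h3
  filter_upwards [h1, h2, h3] with s a1 a2 a3
  rw [acDeriv, hψ.stieltjes_addSMul ψ.hasFiniteVariation_zeroTime, a1, Pi.add_apply, a2,
    Pi.smul_apply, ← a3, smul_eq_mul]
  rfl

/-- The added measure is absolutely continuous: singular masses stay the same, and the density
changes from `0` to `y` almost everywhere on the zero set of `ψ` and nowhere else up to null sets.
-/
lemma integralRate_addSMul_zeroTime_le (hψ : HasFiniteVariation ψ) (hpos : ∀ t, 0 ≤ ψ t)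
    {R : ℝ → ℝ≥0∞} (θdown θup : ℝ≥0∞) {y : ℝ} {ε : ℝ≥0∞} (hy : R y ≤ (⨅ y ≤ (0 : ℝ), R y) + ε) :
    integralRate R θdown θup (ψ.addSMul y ψ.zeroTime) ≤ explicitRate R θdown θup ψ + ε := by
  rw [integralRate, if_pos (hψ.addSMul ψ.hasFiniteVariation_zeroTime y), singularDown, singularUp,
    singularPart_addSMul_zeroTime hψ, explicitRate, add_right_comm _ _ ε, add_right_comm _ _ ε]
  refine add_le_add (add_le_add ?_ le_rfl) le_rfl
  have hε : ε = ∫⁻ _ in Icc (0 : ℝ) 1, ε := by simp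
  conv_rhs => rw [hε]
  rw [← lintegral_add_right _ measurable_const]
  refine lintegral_mono_ae ?_
  rw [← Measure.restrict_congr_set Ioo_ae_eq_Icc, ae_restrict_iff' measurableSet_Ioo]
  filter_upwards [acDeriv_addSMul_zeroTime hψ y, hψ.acDeriv_eq_zero_of_zero] with s a1 a2 hs
  have hsI := Ioo_subset_Icc_self hs
  rcases (extend_nonneg hpos s).lt_or_eq with h | h
  · have hz : ψ.zeroIndicator s = 0 := indicator_of_notMem (fun h' => h.ne' h'.2) _
    rw [indicator_of_mem (show s ∈ {s | 0 < extend ψ s} from h),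
      indicator_of_notMem (show s ∉ {s | extend ψ s = 0} from h.ne'), add_zero, a1, hz, mul_zero,
      add_zero]
    exact le_self_add
  · have hz : ψ.zeroIndicator s = 1 := indicator_of_mem
      (show s ∈ Icc (0 : ℝ) 1 ∩ {s | extend ψ s = 0} from ⟨hsI, h.symm⟩) _
    rw [indicator_of_notMem (show s ∉ {s | 0 < extend ψ s} from fun h' => h.not_lt h'),
      indicator_of_mem (show s ∈ {s | extend ψ s = 0} from h.symm), zero_add, a1, hz,
      a2 hs h.symm, zero_add, mul_one]
    exact hy

theorem contractedRate_integralRate_eq {φ : C(I, ℝ)} (hv : HasVelocity φ ψ) (h0 : ψ 0 = 0)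
    (R : ℝ → ℝ≥0∞) (θdown θup : ℝ≥0∞) :
    contractedRate (integralRate R θdown θup) φ = explicitRate R θdown θup ψ := by
  refine le_antisymm (ENNReal.le_of_forall_pos_le_add fun ε hε _ => ?_) ?_
  · obtain ⟨y, hy0, hy⟩ : ∃ y ≤ (0 : ℝ), R y ≤ (⨅ y ≤ (0 : ℝ), R y) + ε := by
      -- If the infimum is infinite, any `y ≤ 0` will do.
      by_cases htop : (⨅ y ≤ (0 : ℝ), R y) = ⊤
      · exact ⟨0, le_rfl, by rw [htop, top_add]; exact le_top⟩
      · have hlt : (⨅ y ≤ (0 : ℝ), R y) < (⨅ y ≤ (0 : ℝ), R y) + ε :=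
          ENNReal.lt_add_right htop (by exact_mod_cast hε.ne')
        obtain ⟨y, hy⟩ := iInf_lt_iff.1 hlt
        obtain ⟨hy0, hy'⟩ := iInf_lt_iff.1 hy
        exact ⟨y, hy0, hy'.le⟩
    have hr : ReflectsTo (ψ.addSMul y ψ.zeroTime) φ := by
      intro t
      rw [← hv.primitive_eq]
      simp only [reflect_addSMul_zeroTime hv.nonneg h0 hy0]
      rfl
    exact (contractedRate_le _ hr).trans
      (integralRate_addSMul_zeroTime_le hv.hasFiniteVariation hv.nonneg θdown θup hy)
  · exact le_iInf₂ fun γ hγ => explicitRate_le_integralRate hv.hasFiniteVariation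
      (hv.eq_reflect hγ) hv.nonneg h0 hv.tendsto_one R θdown θup

end Formula

lemma exists_of_contractedRate_lt_top {J : SkorohodSpace → ℝ≥0∞} {φ : C(I, ℝ)}
    (h : contractedRate J φ < ⊤) : ∃ γ, ReflectsTo γ φ ∧ J γ < ⊤ := by
  obtain ⟨γ, hγ⟩ := iInf_lt_iff.1 h
  obtain ⟨hr, hJ⟩ := iInf_lt_iff.1 hγ
  exact ⟨γ, hr, hJ⟩

lemma hasFiniteVariation_of_integralRate_lt_top {R : ℝ → ℝ≥0∞} {θdown θup : ℝ≥0∞}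
    {γ : SkorohodSpace} (h : integralRate R θdown θup γ < ⊤) : HasFiniteVariation γ := by
  by_contra hγ
  rw [integralRate, if_neg hγ] at h
  exact lt_irrefl _ h

/-! ### Atoms -/

lemma singularPart_singleton (s : SignedMeasure ℝ) (t : ℝ) :
    s.singularPart volume {t} = s {t} := by
  obtain ⟨N, hN, hN0, hcar⟩ := exists_null_carrier s
  have h := (hcar (N ∪ {t}) (hN.union (measurableSet_singleton t))
    (measure_union_null hN0 Real.volume_singleton) subset_union_left {t}
    (measurableSet_singleton t)).1
  rwa [inter_eq_left.2 subset_union_right] at h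

lemma HasFiniteVariation.stieltjes_singleton {γ : SkorohodSpace} (hγ : HasFiniteVariation γ)
    (t : ℝ) : stieltjes γ {t} =
      ReflectedWalk.extend γ t - Function.leftLim (ReflectedWalk.extend γ) t := by
  rw [← Icc_self, hγ.stieltjes_Icc le_rfl]

lemma singularUp_ne_zero {ψ : SkorohodSpace} (hψ : HasFiniteVariation ψ) (h : 0 < ψ 0) :
    singularUp ψ ≠ 0 := by
  have h1 := ofReal_le_posPart_univ ((stieltjes ψ).singularPart volume) {0}
  rw [singularPart_singleton, hψ.stieltjes_singleton, leftLim_extend_of_nonpos ψ le_rfl, sub_zero,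
    show ReflectedWalk.extend ψ 0 = ψ 0 from extend_coe ψ 0] at h1
  exact ((ENNReal.ofReal_pos.2 h).trans_le h1).ne'

lemma singularPart_eq_zero {γ : SkorohodSpace} (hu : singularUp γ = 0) (hd : singularDown γ = 0) :
    (stieltjes γ).singularPart volume = 0 := by
  refine VectorMeasure.ext fun B _ => ?_
  have h1 : _ ≤ singularUp γ := ofReal_le_posPart_univ ((stieltjes γ).singularPart volume) B
  have h2 := ofReal_le_posPart_univ (-(stieltjes γ).singularPart volume) B
  rw [SignedMeasure.toJordanDecomposition_neg, JordanDecomposition.neg_posPart,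
    _root_.neg_apply] at h2
  change _ ≤ singularDown γ at h2
  rw [hu, nonpos_iff_eq_zero, ENNReal.ofReal_eq_zero] at h1
  rw [hd, nonpos_iff_eq_zero, ENNReal.ofReal_eq_zero] at h2
  exact le_antisymm h1 (neg_nonpos.1 h2)

/-- Paths whose measure is absolutely continuous are left-continuous. -/
lemma HasFiniteVariation.tendsto_left {γ : SkorohodSpace} (hγ : HasFiniteVariation γ)
    (h : (stieltjes γ).singularPart volume = 0) {t : I} (ht : 0 < t) :
    Tendsto γ.toFun (𝓝[<] t) (𝓝 (γ t)) := by
  obtain ⟨l, hl⟩ := γ.left_limit t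
  have h1 := hγ.stieltjes_singleton t
  rw [← singularPart_singleton, h, leftLim_eq_of_tendsto (tendsto_extend_left ht hl),
    extend_coe] at h1
  have h2 : γ t = l := by
    simpa using (sub_eq_zero.1 h1.symm)
  rwa [h2]

namespace SkorohodSpace

/-- The running infimum can drop at `t` only if `γ` itself jumps down there. -/
lemma tendsto_runningInf_left {γ : SkorohodSpace} {t : I} (ht : 0 < t)
    (h : Tendsto γ.toFun (𝓝[<] t) (𝓝 (γ t))) :
    Tendsto γ.runningInf (𝓝[<] t) (𝓝 (γ.runningInf t)) := by
  have hne : (𝓝[<] t).NeBot := nhdsLT_neBot_of_exists_lt ⟨0, ht⟩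
  obtain ⟨M, hM⟩ := γ.runningInfPath.left_limit t
  have h1 : ∀ s < t, M ≤ γ.runningInf s := fun s hs => by
    refine le_of_tendsto hM ?_
    filter_upwards [Ioo_mem_nhdsLT hs] with u hu
    exact γ.antitone_runningInf hu.1.le
  have h2 : M = γ.runningInf t := by
    refine le_antisymm (γ.le_runningInf fun s hs => ?_) (ge_of_tendsto hM ?_)
    · rcases hs.lt_or_eq with hs | rfl
      · exact (h1 s hs).trans (γ.runningInf_le le_rfl)
      · refine ge_of_tendsto h ?_
        filter_upwards [self_mem_nhdsWithin] with u hu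
        exact (h1 u hu).trans (γ.runningInf_le le_rfl)
    · filter_upwards [self_mem_nhdsWithin] with u hu
      exact γ.antitone_runningInf (le_of_lt hu)
  rw [← h2]
  exact hM

lemma tendsto_reflectPath_left {γ : SkorohodSpace} {t : I} (ht : 0 < t)
    (h : Tendsto γ.toFun (𝓝[<] t) (𝓝 (γ t))) :
    Tendsto γ.reflectPath.toFun (𝓝[<] t) (𝓝 (γ.reflectPath t)) :=
  h.add ((tendsto_runningInf_left ht h).const_mul (-1))

lemma leftAtOne_eq {h : SkorohodSpace} (h1 : Tendsto h.toFun (𝓝[<] 1) (𝓝 (h 1))) (t : I) :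
    h.leftAtOne t = h t := by
  rcases (show t ≤ 1 from unitInterval.le_one').lt_or_eq with ht | rfl
  · exact h.leftAtOne_of_lt ht
  · have : (𝓝[<] (1 : I)).NeBot := nhdsLT_neBot_of_exists_lt ⟨0, one_pos⟩
    exact tendsto_nhds_unique h.tendsto_leftAtOne h1

lemma hasDerivWithinAt_primitive {h : SkorohodSpace}
    (hl : ∀ t : I, 0 < t → Tendsto h.toFun (𝓝[<] t) (𝓝 (h t))) (t : I) :
    HasDerivWithinAt (IccExtend zero_le_one h.primitive) (h t) (Icc (0 : ℝ) 1) t := by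
  rcases (show 0 ≤ t from unitInterval.nonneg').eq_or_lt with rfl | h0
  · exact (h.hasDerivWithinAt_primitive_right one_pos).mono Icc_subset_Ici_self
  have h2 := h.hasDerivWithinAt_primitive_left h0 (hl t h0)
  rcases (show t ≤ 1 from unitInterval.le_one').eq_or_lt with rfl | h1
  · exact h2.mono Icc_subset_Iic_self
  · refine (h2.union (h.hasDerivWithinAt_primitive_right h1)).mono ?_
    rw [Iic_union_Ici]
    exact subset_univ _

/-! ### Paths with a jump at the origin in the limit -/

/-- Jumps of a fixed size at times that decrease to `0` do not converge in `J₁`. -/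
lemma not_isCompact_of_jumps {γ : SkorohodSpace} {c : ℝ} (hc : c ≠ 0) {a : ℕ → I}
    (ha0 : ∀ n, 0 < a n) (ha : Tendsto a atTop (𝓝 0)) {K : Set SkorohodSpace}
    (hK : ∀ n, γ.addSMul c (stepPath (a n)) ∈ K) : ¬ IsCompact K := by
  intro hcomp
  obtain ⟨χ, -, f, hf, hlim⟩ := hcomp.tendsto_subseq hK
  have hη : 0 < |c| / 4 := by positivity
  have hev : ∀ ε > 0, ∀ᶠ n in atTop,
      edist (γ.addSMul c (stepPath (a (f n)))) χ < ENNReal.ofReal ε := fun ε hε =>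
    (EMetric.tendsto_nhds.1 hlim) _ (ENNReal.ofReal_pos.2 hε)
  have h0 : γ 0 = χ 0 := by
    refine eq_of_abs_sub_le_all fun ε hε => ?_
    -- Time changes fix `0`, and the added jump has not yet happened there.
    obtain ⟨n, hn⟩ := (hev ε hε).exists
    obtain ⟨lam, h1, -⟩ := exists_timeChange hn
    have := h1 0
    rw [show lam 0 = 0 from lam.map_bot, addSMul_apply, stepPath_of_lt (ha0 _), mul_zero,
      add_zero] at this
    exact this.le
  have hr : ∀ φ : SkorohodSpace, ∃ δ > 0, ∀ t : I, (t : ℝ) < δ → |φ t - φ 0| < |c| / 4 :=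
    fun φ => by
      obtain ⟨δ, hδ, h⟩ := Metric.continuousWithinAt_iff.1 (φ.right_continuous 0) _ hη
      refine ⟨δ, hδ, fun t ht => ?_⟩
      have := h (show t ∈ Ici 0 from unitInterval.nonneg') (by
        rw [Subtype.dist_eq, Real.dist_eq]
        simpa [abs_of_nonneg t.2.1] using ht)
      rwa [Real.dist_eq] at this
  obtain ⟨δ₁, hδ₁, h1⟩ := hr γ
  obtain ⟨δ₂, hδ₂, h2⟩ := hr χ
  obtain ⟨δ, hδ, hδ1, hδ2, hδ3⟩ : ∃ δ > 0, δ ≤ δ₁ ∧ δ ≤ δ₂ ∧ δ ≤ 1 :=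
    ⟨min (min δ₁ δ₂) 1, by positivity, (min_le_left _ _).trans (min_le_left _ _),
      (min_le_left _ _).trans (min_le_right _ _), min_le_right _ _⟩
  have ha' : ∀ᶠ n in atTop, (a (f n) : ℝ) < δ / 4 :=
    ((continuous_subtype_val.tendsto (0 : I)).comp
      (ha.comp hf.tendsto_atTop)).eventually_lt_const (by simpa using hδ)
  obtain ⟨n, hn, han⟩ := ((hev (min (|c| / 4) (δ / 4)) (by positivity)).and ha').exists
  obtain ⟨lam, hl1, hl2⟩ := exists_timeChange hn
  -- The time change moves `δ / 2` by less than `δ / 4`, hence to a point past the jump at `a (f n)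
  -- < δ / 4` and still below `δ`. There the path is near `γ 0 + c`, while `χ` is near `χ 0 = γ 0`;
  -- three errors below `|c| / 4` cannot make up for `c`.
  have ht : δ / 2 ∈ Icc (0 : ℝ) 1 := ⟨by linarith, by linarith⟩
  have b1 := (hl1 ⟨δ / 2, ht⟩).trans_le (min_le_left _ _)
  have b2 := abs_lt.1 ((hl2 ⟨δ / 2, ht⟩).trans_le (min_le_right _ _))
  have b3 := h2 ⟨δ / 2, ht⟩ (show δ / 2 < δ₂ by linarith)
  simp only at b2
  have b4 := h1 (lam ⟨δ / 2, ht⟩) (by linarith)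
  have hle : a (f n) ≤ lam ⟨δ / 2, ht⟩ := Subtype.coe_le_coe.1 (by linarith)
  rw [addSMul_apply, stepPath_of_le hle, mul_one] at b1
  have e : c = (γ (lam ⟨δ / 2, ht⟩) + c - χ ⟨δ / 2, ht⟩) + (χ ⟨δ / 2, ht⟩ - χ 0)
      - (γ (lam ⟨δ / 2, ht⟩) - γ 0) := by rw [h0]; ring
  have := abs_sub (γ (lam ⟨δ / 2, ht⟩) + c - χ ⟨δ / 2, ht⟩ + (χ ⟨δ / 2, ht⟩ - χ 0))
    (γ (lam ⟨δ / 2, ht⟩) - γ 0)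
  rw [← e] at this
  have := abs_add_le (γ (lam ⟨δ / 2, ht⟩) + c - χ ⟨δ / 2, ht⟩) (χ ⟨δ / 2, ht⟩ - χ 0)
  linarith

/-! ### The cost of adding one jump -/

lemma hasFiniteVariation_stepPath (a : I) : HasFiniteVariation (stepPath a) :=
  hasFiniteVariation_of_monotone (monotone_stepPath a)

lemma stieltjes_stepPath (a : I) :
    stieltjes (stepPath a) = VectorMeasure.dirac (a : ℝ) 1 := by
  have hext : ∀ t : ℝ, extend (stepPath a) t = if (a : ℝ) ≤ t then 1 else 0 := by
    intro t
    rcases lt_or_ge t 0 with h | h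
    · rw [extend_of_neg _ h, if_neg (not_le.2 (h.trans_le a.2.1))]
    rw [extend_of_nonneg _ h]
    split_ifs with h'
    · exact stepPath_of_le (Subtype.coe_le_coe.1
        (by rw [coe_projIcc]; exact le_max_of_le_right (le_min a.2.2 h')))
    · refine stepPath_of_lt (Subtype.coe_lt_coe.1 ?_)
      rw [projIcc_of_mem zero_le_one ⟨h, (not_le.1 h').le.trans a.2.2⟩]
      exact not_le.1 h'
  refine signedMeasure_ext_of_Icc fun c d hcd => ?_
  have hl : Function.leftLim (extend (stepPath a)) c = if (a : ℝ) < c then 1 else 0 := by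
    refine leftLim_eq_of_tendsto ?_
    split_ifs with h
    · refine tendsto_const_nhds.congr' ?_
      filter_upwards [Ioo_mem_nhdsLT h] with s hs
      rw [hext, if_pos hs.1.le]
    · refine tendsto_const_nhds.congr' ?_
      filter_upwards [self_mem_nhdsWithin] with s hs
      rw [hext, if_neg (not_le.2 (lt_of_lt_of_le hs (not_lt.1 h)))]
  rw [(hasFiniteVariation_stepPath a).stieltjes_Icc hcd, hl, hext]
  by_cases h1 : (a : ℝ) ∈ Icc c d
  · rw [VectorMeasure.dirac_apply_of_mem measurableSet_Icc h1, if_pos h1.2,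
      if_neg (not_lt.2 h1.1), sub_zero]
  · rw [VectorMeasure.dirac_apply_of_notMem h1]
    rcases lt_or_ge (a : ℝ) c with h2 | h2
    · rw [if_pos h2, if_pos (h2.le.trans hcd), sub_self]
    · rw [if_neg (not_lt.2 h2), if_neg fun h3 => h1 ⟨h2, h3⟩, sub_self]

lemma stieltjes_stepPath_mem (a : I) (B : Set ℝ) :
    stieltjes (stepPath a) B ∈ Icc (0 : ℝ) 1 := by
  rw [stieltjes_stepPath]
  by_cases hB : MeasurableSet B
  · by_cases h : (a : ℝ) ∈ B
    · simp [VectorMeasure.dirac_apply_of_mem hB h]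
    · simp [VectorMeasure.dirac_apply_of_notMem h]
  · simp [VectorMeasure.not_measurable _ hB]

lemma singularPart_stepPath (a : I) :
    (stieltjes (stepPath a)).singularPart volume = stieltjes (stepPath a) := by
  refine (SignedMeasure.eq_singularPart _ 0 ?_ (by simp)).symm
  refine ⟨{(a : ℝ)}ᶜ, (measurableSet_singleton _).compl, fun B hB => ?_, fun B hB => ?_⟩
  · rw [stieltjes_stepPath]
    exact VectorMeasure.dirac_apply_of_notMem fun h => hB h rfl
  · rw [compl_compl] at hB
    have hBm : MeasurableSet B := ((finite_singleton (a : ℝ)).subset hB).measurableSet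
    rw [Measure.toENNRealVectorMeasure_apply_measurable hBm]
    exact measure_mono_null hB Real.volume_singleton

lemma rnDeriv_stepPath (a : I) :
    ∀ᵐ s, (stieltjes (stepPath a)).rnDeriv volume s = 0 := by
  filter_upwards [rnDeriv_eq_zero_of_eq_zero (s := stieltjes (stepPath a))
    (measurableSet_singleton (a : ℝ)).compl fun B hB _ => by
      rw [stieltjes_stepPath]
      exact VectorMeasure.dirac_apply_of_notMem fun h => hB h rfl,
    compl_mem_ae_iff.2 (Real.volume_singleton (a := (a : ℝ)))] with s h1 h2
  exact h1 h2

end SkorohodSpace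

lemma posPart_univ_add_smul_le (s t : SignedMeasure ℝ) (ht : ∀ B, t B ∈ Icc (0 : ℝ) 1) (c : ℝ) :
    (s + c • t).toJordanDecomposition.posPart univ ≤
      s.toJordanDecomposition.posPart univ + ENNReal.ofReal c := by
  obtain ⟨A, -, hA⟩ := exists_posPart_univ_eq (s + c • t)
  rw [hA, _root_.add_apply, _root_.smul_apply, smul_eq_mul]
  refine ENNReal.ofReal_add_le.trans (add_le_add (ofReal_le_posPart_univ s A) ?_)
  rcases le_or_gt c 0 with hc | hc
  · rw [ENNReal.ofReal_of_nonpos (mul_nonpos_of_nonpos_of_nonneg hc (ht A).1)]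
    exact zero_le
  · exact ENNReal.ofReal_le_ofReal (mul_le_of_le_one_right hc.le (ht A).2)

lemma integralRate_addSMul_stepPath_le (R : ℝ → ℝ≥0∞) (θdown θup : ℝ≥0∞) {γ : SkorohodSpace}
    (hγ : HasFiniteVariation γ) (c : ℝ) (a : I) :
    integralRate R θdown θup (γ.addSMul c (stepPath a)) ≤
      integralRate R θdown θup γ + θdown * ENNReal.ofReal (-c) + θup * ENNReal.ofReal c := by
  have hm := hγ.stieltjes_addSMul (hasFiniteVariation_stepPath a) c
  have hs : (stieltjes (γ.addSMul c (stepPath a))).singularPart volume =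
      (stieltjes γ).singularPart volume + c • stieltjes (stepPath a) := by
    rw [hm, SignedMeasure.singularPart_add, SignedMeasure.singularPart_smul,
      singularPart_stepPath]
  have hu : singularUp (γ.addSMul c (stepPath a)) ≤ singularUp γ + ENNReal.ofReal c := by
    rw [singularUp, hs]
    exact posPart_univ_add_smul_le _ _ (stieltjes_stepPath_mem a) c
  have hd : singularDown (γ.addSMul c (stepPath a)) ≤ singularDown γ + ENNReal.ofReal (-c) := by
    rw [singularDown, singularDown, hs, ← JordanDecomposition.neg_posPart,
      ← JordanDecomposition.neg_posPart, ← SignedMeasure.toJordanDecomposition_neg,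
      ← SignedMeasure.toJordanDecomposition_neg, neg_add,
      show -(c • stieltjes (stepPath a)) = (-c) • stieltjes (stepPath a) from
        VectorMeasure.ext fun B _ => by
          rw [_root_.neg_apply, _root_.smul_apply, _root_.smul_apply, neg_smul]]
    exact posPart_univ_add_smul_le _ _ (stieltjes_stepPath_mem a) (-c)
  have hac : ∀ᵐ s, acDeriv (γ.addSMul c (stepPath a)) s = acDeriv γ s := by
    filter_upwards [(stieltjes γ).rnDeriv_add (c • stieltjes (stepPath a)) volume,
      (stieltjes (stepPath a)).rnDeriv_smul volume c, rnDeriv_stepPath a] with s a1 a2 a3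
    rw [acDeriv, hm, a1, Pi.add_apply, a2, Pi.smul_apply, a3, smul_zero, add_zero]
    rfl
  have hi : (∫⁻ s in Icc (0 : ℝ) 1, R (acDeriv (γ.addSMul c (stepPath a)) s)) =
      ∫⁻ s in Icc (0 : ℝ) 1, R (acDeriv γ s) :=
    lintegral_congr_ae (ae_restrict_of_ae (hac.mono fun s h => by simp only [h]))
  rw [integralRate, integralRate, if_pos hγ,
    if_pos (hγ.addSMul (hasFiniteVariation_stepPath a) c), hi]
  calc _ ≤ _ + θdown * (singularDown γ + ENNReal.ofReal (-c))
        + θup * (singularUp γ + ENNReal.ofReal c) := by gcongr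
    _ = _ := by ring

/-- Goodness of the rate function forces the cost of jumps to be infinite. -/
lemma IsGoodRateFunction.eq_top {R : ℝ → ℝ≥0∞} {θdown θup : ℝ≥0∞}
    (h : IsGoodRateFunction (integralRate R θdown θup)) {γ : SkorohodSpace}
    (hγ : integralRate R θdown θup γ < ⊤) : θdown = ⊤ ∧ θup = ⊤ := by
  -- If the price of a jump `c` were finite, adding it to `γ` at the times `1 / (n + 1)` would stay
  -- inside one sublevel set. The signs `-1` and `1` of `c` isolate the two prices.
  have key : ∀ c : ℝ, c ≠ 0 →
      θdown * ENNReal.ofReal (-c) + θup * ENNReal.ofReal c = ⊤ := by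
    intro c hc
    by_contra hne
    have hlt := ENNReal.add_lt_top.2 ⟨hγ, lt_top_iff_ne_top.2 hne⟩
    have ha0 : ∀ n : ℕ, 0 < (⟨1 / (n + 1 : ℝ), by positivity, by
      rw [div_le_one (by positivity)]; linarith [n.cast_nonneg (α := ℝ)]⟩ : I) := fun n =>
        Subtype.coe_lt_coe.1 (show (0 : ℝ) < 1 / (n + 1 : ℝ) by positivity)
    refine not_isCompact_of_jumps (γ := γ) hc ha0
      (tendsto_subtype_rng.2 tendsto_one_div_add_atTop_nhds_zero_nat) (fun n => ?_)
      (h.isCompact_sublevel (integralRate R θdown θup γ +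
        (θdown * ENNReal.ofReal (-c) + θup * ENNReal.ofReal c)).toNNReal)
    refine (integralRate_addSMul_stepPath_le R θdown θup
      (hasFiniteVariation_of_integralRate_lt_top hγ) c _).trans ?_
    rw [ENNReal.coe_toNNReal hlt.ne, add_assoc]
  constructor
  · simpa [ENNReal.ofReal_of_nonpos] using key (-1) (by norm_num)
  · simpa [ENNReal.ofReal_of_nonpos] using key 1 one_ne_zero

/-- The whole space has probability one, so the upper bound for it reads `0 ≤ -inf J`, which fails
if `J` is identically infinite. -/
lemma SatisfiesLDP.exists_lt_top {Ω E : Type*} [MeasurableSpace Ω] [TopologicalSpace E]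
    {P : Measure Ω} [IsProbabilityMeasure P] {Y : ℕ → Ω → E} {a : ℕ → ℝ} {J : E → ℝ≥0∞}
    (h : SatisfiesLDP P Y a J) : ∃ x, J x < ⊤ := by
  have h1 := h.upper univ isClosed_univ
  simp only [preimage_univ, measure_univ, ENNReal.log_one, EReal.zero_div, limsup_const,
    mem_univ, iInf_true] at h1
  by_contra! hne
  rw [show (⨅ x, J x) = ⊤ from iInf_eq_top.2 fun x => top_le_iff.1 (hne x)] at h1
  simp at h1

lemma singularPart_eq_zero_of_integralRate_lt_top {R : ℝ → ℝ≥0∞} {γ : SkorohodSpace}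
    (h : integralRate R ⊤ ⊤ γ < ⊤) : (stieltjes γ).singularPart volume = 0 := by
  rw [integralRate, if_pos (hasFiniteVariation_of_integralRate_lt_top h), ENNReal.add_lt_top,
    ENNReal.add_lt_top] at h
  refine singularPart_eq_zero ?_ ?_
  · by_contra hne
    exact h.2.ne (ENNReal.top_mul hne)
  · by_contra hne
    exact h.1.2.ne (ENNReal.top_mul hne)

lemma contractedRate_eq_explicitRate_top (R : ℝ → ℝ≥0∞) {φ : C(I, ℝ)} {ψ : SkorohodSpace}
    (hv : HasVelocity φ ψ) : contractedRate (integralRate R ⊤ ⊤) φ = explicitRate R ⊤ ⊤ ψ := by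
  by_cases h0 : ψ 0 = 0
  · exact contractedRate_integralRate_eq hv h0 R ⊤ ⊤
  -- The explicit rate is infinite by the atom `ψ 0` at the origin. The contracted rate is an
  -- infimum over the empty set, since every reflection starts at `0`.
  · have h1 := singularUp_ne_zero hv.hasFiniteVariation (lt_of_le_of_ne (hv.nonneg 0) (Ne.symm h0))
    rw [explicitRate, ENNReal.top_mul h1, add_top, ← top_le_iff]
    refine le_iInf₂ fun γ hγ => absurd ?_ h0
    rw [hv.eq_reflect hγ 0 one_pos, reflect_zero]

end ReflectedWalk

theorem theorem1 {Ω : Type*} [MeasurableSpace Ω] (P : Measure Ω) [IsProbabilityMeasure P]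
    (X : ℕ → Ω → ℝ) (hX : ∀ i, Measurable (X i))
    (a : ℕ → ℝ) (ha : Tendsto a atTop atTop)
    (J : SkorohodSpace → ℝ≥0∞) (hJ : IsGoodRateFunction J)
    (hLDP : SatisfiesLDP P (fun n ω => walkPath (fun i => X i ω) n) a J) :
    -- the LDP for the simulated mean paths
    (SatisfiesLDP P (fun n ω => meanPath (fun i => X i ω) n) a (contractedRate J) ∧
      IsGoodRateFunction (contractedRate J) ∧
      ((∀ γ, ¬ HasFiniteVariation γ → J γ = ⊤) → ∀ φ, contractedRate J φ =
        ⨅ (γ : SkorohodSpace) (_ : HasFiniteVariation γ) (_ : ReflectsTo γ φ), J γ)) ∧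
    -- the explicit formula when `J` is of the integral form
    (∀ (R : ℝ → ℝ≥0∞) (θdown θup : ℝ≥0∞), J = integralRate R θdown θup →
      (∀ φ, contractedRate J φ < ⊤ → ∃ ψ, HasVelocity φ ψ ∧ ∀ t : unitInterval,
        HasDerivWithinAt (IccExtend zero_le_one φ) (ψ t) (Icc (0 : ℝ) 1) t) ∧
      (∀ φ ψ, HasVelocity φ ψ → contractedRate J φ = explicitRate R θdown θup ψ)) ∧
    -- the same formula for functionals of the integral form, whether or not they govern an LDP
    (∀ (R : ℝ → ℝ≥0∞) (θdown θup : ℝ≥0∞),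
      (∀ φ, contractedRate (integralRate R θdown θup) φ < ⊤ →
        ∃ ψ, HasVelocity φ ψ ∧ ψ 0 = 0) ∧
      (∀ φ ψ, HasVelocity φ ψ → ψ 0 = 0 →
        contractedRate (integralRate R θdown θup) φ = explicitRate R θdown θup ψ)) := by
  refine ⟨⟨hLDP.meanPath ha hJ, hJ.contractedRate, contractedRate_eq_of_top⟩,
    fun R θdown θup hR => ?_, fun R θdown θup => ⟨fun φ hφ => ?_, fun φ ψ hv h0 =>
      contractedRate_integralRate_eq hv h0 R θdown θup⟩⟩
  · subst hR
    obtain ⟨γ₀, h₀⟩ := hLDP.exists_lt_top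
    obtain ⟨rfl, rfl⟩ := hJ.eq_top h₀
    refine ⟨fun φ hφ => ?_, fun φ ψ hv => contractedRate_eq_explicitRate_top R hv⟩
    obtain ⟨γ, hγ, hfin⟩ := exists_of_contractedRate_lt_top hφ
    have hfv := hasFiniteVariation_of_integralRate_lt_top hfin
    -- With infinite jump prices `γ` has no singular part, hence is left-continuous, and so is its
    -- reflection; the primitive is then differentiable at every point.
    have hleft : ∀ t : I, 0 < t → Tendsto γ.reflectPath.toFun (𝓝[<] t) (𝓝 (γ.reflectPath t)) :=
      fun t ht => SkorohodSpace.tendsto_reflectPath_left ht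
        (hfv.tendsto_left (singularPart_eq_zero_of_integralRate_lt_top hfin) ht)
    refine ⟨_, (hγ.exists_hasVelocity hfv).1, fun t => ?_⟩
    rw [SkorohodSpace.leftAtOne_eq (hleft 1 one_pos), ← (γ.reflectsTo_iff φ).1 hγ]
    exact SkorohodSpace.hasDerivWithinAt_primitive hleft t
  · obtain ⟨γ, hγ, hfin⟩ := exists_of_contractedRate_lt_top hφ
    exact ⟨_, hγ.exists_hasVelocity (hasFiniteVariation_of_integralRate_lt_top hfin)⟩
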